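/- Let $(M^{2n},J,g)$ be a nearly Kähler manifold, i.e. a smooth manifold with a Riemannian metric $g$ and a $g$-orthogonal almost complex structure $J$ such that $(\nabla^{LC}_XJ)X=0$ for all $X\in TM$, where $\nabla^{LC}$ is the Levi-Civita connection of $g$. Let $\omega(X,Y)=g(JX,Y)$, and let $L^n$ be a Lagrangian submanifold of $M$ (possibly only immersed), i.e. $\omega|_L=0$. Let $H_L$ be the mean curvature vector of $L$, the trace over an orthonormal basis (not divided by $n$) of the second fundamental form of $L$ with respect to $\nabla^{LC}$. Then $M$ carries a canonical Hermitian connection $\nabla^{can}$, i.e. a connection on $TM$ with $\nabla^{can}g=0$, $\nabla^{can}J=0$ whose torsion satisfies $T(JX,Y)=T(X,JY)$. Let $(\alpha^i_j)$ be its connection form on the bundle $U(M)$ of unitary frames $(e_1,Je_1,\dots,e_n,Je_n)$ (so that $\nabla^{can}e_j=\sum_i\alpha^i_j e_i$ along a frame, $\sqrt{-1}$ acting as $J$) and put $\gamma=-\sqrt{-1}\sum_i\alpha^i_i$. There is exactly one real 1-form $\mu(L)$ on $L$, the Maslov 1-form of $L$, such that $\mu(L)=2s^*\gamma$ for every local smooth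 lift $s$ to $U(M)$ of the Gauss map $p\mapsto T_pL$, that is, for every local orthonormal frame $s=(e_1,\dots,e_n)$ of $TL$ regarded as the unitary frame $(e_1,Je_1,\dots,e_n,Je_n)$ of $M$ along $L$. This form satisfies $$-2\,L_\omega(H_L)|_{TL}=\mu(L),\qquad\text{where } L_\omega(V)=\omega(V,\cdot).$$ Consequently, if $L$ is minimal ($H_L=0$), then the first Chern form $\frac{\sqrt{-1}}{2\pi}\operatorname{tr}_{\mathbb C}R^{can}=-\frac1{2\pi}d\gamma$ of $(M,J,g)$, where $R^{can}$ is the curvature of $\nabla^{can}$, restricts to zero on $L$. -/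

import Mathlib

open Bundle
open scoped Manifold ContDiff

noncomputable section

namespace NearlyKahler

section Ambient

variable {E : Type*} [NormedAddCommGroup E] [NormedSpace ℝ E] [FiniteDimensional ℝ E]
  {H : Type*} [TopologicalSpace H] {I : ModelWithCorners ℝ E H}
  {M : Type*} [TopologicalSpace M] [ChartedSpace H M] [IsManifold I ∞ M]
  [RiemannianBundle (fun x : M => TangentSpace I x)]
  [IsContMDiffRiemannianBundle I ∞ E (fun x : M => TangentSpace I x)]

/-- `J` is a smooth almost complex structure which is orthogonal for the Riemannian metric `g`
carried by the tangent bundle, so that `(M, J, g)` is an almost Hermitian manifold. -/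
structure IsAlmostHermitian
    (J : Π x : M, TangentSpace I x →L[ℝ] TangentSpace I x) : Prop where
  smooth : ContMDiff I (I.prod 𝓘(ℝ, E →L[ℝ] E)) ∞
    (fun x => TotalSpace.mk' (E →L[ℝ] E) (E := fun x : M => TangentSpace I x →L[ℝ] TangentSpace I x)
      x (J x))
  sq (x : M) (v : TangentSpace I x) : J x (J x v) = -v
  orthogonal (x : M) (v w : TangentSpace I x) : inner ℝ (J x v) (J x w) = inner ℝ v w

/-- `∇ g = 0`: if `Y` and `Z` are differentiable at `x`, then
`v (g (Y, Z)) = g (∇_v Y, Z) + g (Y, ∇_v Z)` for all `v` in `T_x M`. -/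
def IsMetric (D : CovariantDerivative I E (fun x : M => TangentSpace I x)) : Prop :=
  ∀ (x : M) (Y Z : Π y : M, TangentSpace I y) (v : TangentSpace I x),
    MDiffAt (T% Y) x → MDiffAt (T% Z) x →
      mvfderiv I (fun y => (inner ℝ (Y y) (Z y) : ℝ)) x v
        = inner ℝ (D Y x v) (Z x) + inner ℝ (Y x) (D Z x v)

/-- The Levi-Civita connection of `g`: the smooth, metric, torsion-free connection on `TM`. -/
structure IsLeviCivita (D : CovariantDerivative I E (fun x : M => TangentSpace I x)) : Prop where
  smooth : D.ContMDiffCovariantDerivative ∞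
  metric : IsMetric D
  torsion_eq_zero : D.torsion = 0

/-- `(∇_X J) X = 0` for all `X`, where `(∇_X J) Y = ∇_X (J Y) - J (∇_X Y)`; recall that
`D Y x (X x)` denotes `(∇_X Y)(x)`. -/
def IsNearlyKahler (J : Π x : M, TangentSpace I x →L[ℝ] TangentSpace I x)
    (D : CovariantDerivative I E (fun x : M => TangentSpace I x)) : Prop :=
  ∀ (x : M) (X : Π y : M, TangentSpace I y), MDiffAt (T% X) x →
    D (fun y => J y (X y)) x (X x) - J x (D X x (X x)) = 0

/-- The canonical Hermitian connection of `(M, J, g)`: the smooth connection on `TM` which is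
unitary (`∇ g = 0` and `∇ J = 0`) and whose torsion satisfies `T (J X, Y) = T (X, J Y)`. -/
structure IsCanonicalHermitian (J : Π x : M, TangentSpace I x →L[ℝ] TangentSpace I x)
    (D : CovariantDerivative I E (fun x : M => TangentSpace I x)) : Prop where
  smooth : D.ContMDiffCovariantDerivative ∞
  metric : IsMetric D
  parallel (x : M) (Y : Π y : M, TangentSpace I y) (v : TangentSpace I x) :
    MDiffAt (T% Y) x → D (fun y => J y (Y y)) x v = J x (D Y x v)
  torsion_type (x : M) (u v : TangentSpace I x) : D.torsion x (J x u) v = D.torsion x u (J x v)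

/-- The map `L_ω : TM → T^*M`, `L_ω V = ω (V, ·)`, where `ω (V, W) = g (J V, W)` is the
fundamental 2-form. -/
def lOmega (J : Π x : M, TangentSpace I x →L[ℝ] TangentSpace I x) (x : M)
    (V : TangentSpace I x) : TangentSpace I x →L[ℝ] ℝ :=
  innerSL ℝ (J x V)

/-- The curvature `R (u, v) w = ∇_U ∇_V W - ∇_V ∇_U W - ∇_[U, V] W` of a connection on `TM`, where
`U, V, W` are the extensions of `u, v, w` to vector fields that are constant in a local
trivialization of `TM` around `x`. -/
def curvature (D : CovariantDerivative I E (fun x : M => TangentSpace I x)) (x : M)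
    (u v w : TangentSpace I x) : TangentSpace I x :=
  letI U : Π y : M, TangentSpace I y := FiberBundle.extend E u
  letI V : Π y : M, TangentSpace I y := FiberBundle.extend E v
  letI W : Π y : M, TangentSpace I y := FiberBundle.extend E w
  D (fun y => D W y (V y)) x u - D (fun y => D W y (U y)) x v
    - D W x (VectorField.mlieBracket I U V x)

instance (x : M) : FiniteDimensional ℝ (TangentSpace I x) :=
  inferInstanceAs (FiniteDimensional ℝ E)

/-- The complex trace `(tr_ℝ A - i tr_ℝ (J A)) / 2` of a `J`-linear endomorphism `A` of `T_x M`,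
the real traces being computed in an orthonormal basis. -/
def complexTrace (J : Π x : M, TangentSpace I x →L[ℝ] TangentSpace I x) (x : M)
    (A : TangentSpace I x → TangentSpace I x) : ℂ :=
  letI b := stdOrthonormalBasis ℝ (TangentSpace I x)
  (1 / 2 : ℂ) * ∑ k, (((inner ℝ (b k) (A (b k)) : ℝ) : ℂ)
    - Complex.I * ((inner ℝ (b k) (J x (A (b k))) : ℝ) : ℂ))

/-- The first Chern form `(i / 2π) tr_ℂ Ω` of the unitary connection `D`, where `Ω` is its
curvature. If `α` is the connection form, `Ω` the curvature form and `γ = -i ∑ α^i_i`, then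
`tr_ℂ Ω = i dγ`, so this form is `-(1 / 2π) dγ`. -/
def firstChernForm (J : Π x : M, TangentSpace I x →L[ℝ] TangentSpace I x)
    (D : CovariantDerivative I E (fun x : M => TangentSpace I x)) (x : M)
    (u v : TangentSpace I x) : ℂ :=
  Complex.I / (2 * (Real.pi : ℂ)) * complexTrace J x (fun w => curvature D x u v w)

/-- `(e_1, J e_1, …, e_n, J e_n)` is a unitary frame at `x`, i.e. it is orthonormal for `g`;
since `J` is orthogonal this is expressed by the inner products below. -/
def IsUnitaryFrame (J : Π x : M, TangentSpace I x →L[ℝ] TangentSpace I x) {n : ℕ} (x : M)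
    (e : Fin n → TangentSpace I x) : Prop :=
  Orthonormal ℝ e ∧ ∀ i j, inner ℝ (e i) (J x (e j)) = 0

section Submanifold

variable {E' : Type*} [NormedAddCommGroup E'] [NormedSpace ℝ E']
  {H' : Type*} [TopologicalSpace H'] {I' : ModelWithCorners ℝ E' H'}
  {L : Type*} [TopologicalSpace L] [ChartedSpace H' L]

variable (I I') in
/-- The map `f` is a smooth immersion and `f^* ω = 0`. -/
structure IsLagrangianImmersion (J : Π x : M, TangentSpace I x →L[ℝ] TangentSpace I x)
    (f : L → M) : Prop where
  smooth : ContMDiff I' I ∞ f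
  immersion (p : L) : Function.Injective (mfderiv I' I f p)
  lagrangian (p : L) (u v : TangentSpace I' p) :
    lOmega J (f p) (mfderiv I' I f p u) (mfderiv I' I f p v) = 0

variable (I') in
/-- The covariant derivative, with respect to the pull-back connection `f^* D`, of a vector field
`s` along `f`: in the local trivialization of `TM` around `f p`, with local frame `(E_k)`, write
`s q = ∑ s^k(q) E_k (f q)`; then `D_v s = ∑ (d s^k (v) E_k + s^k(p) D_{df v} E_k)`. -/
def covAlong (D : CovariantDerivative I E (fun x : M => TangentSpace I x)) (f : L → M)
    (s : Π q : L, TangentSpace I (f q)) (p : L) : TangentSpace I' p →L[ℝ] TangentSpace I (f p) :=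
  letI t := trivializationAt E (fun x : M => TangentSpace I x) (f p)
  (t.symmL ℝ (f p)).comp (mvfderiv I' (fun q => (t ⟨f q, s q⟩).2) p)
    + (D (FiberBundle.extend E (s p)) (f p)).comp (mfderiv I' I f p)

variable (I I') in
/-- The Gauss map: `p` is sent to the subspace `df (T_p L)` of `T_{f p} M`. -/
def gaussMap (f : L → M) (p : L) : Submodule ℝ (TangentSpace I (f p)) :=
  LinearMap.range (mfderiv I' I f p).toLinearMap

instance (f : L → M) (p : L) : FiniteDimensional ℝ (gaussMap I I' f p) :=
  FiniteDimensional.finiteDimensional_submodule _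

section SecondFundamentalForm

variable [IsManifold I' ∞ L]

/-- The second fundamental form `B (u, v) = (D_u (df V))^⊥` of `f` with respect to the connection
`D`, where the vector field `V` extends `v` and is constant in a local trivialization of `TL`. -/
def secondFundamentalForm (D : CovariantDerivative I E (fun x : M => TangentSpace I x))
    (f : L → M) (p : L) (u v : TangentSpace I' p) : TangentSpace I (f p) :=
  letI w : TangentSpace I (f p) :=
    covAlong I' D f (fun q => mfderiv I' I f q (FiberBundle.extend E' v q)) p u
  w - (gaussMap I I' f p).starProjection w

variable (I') in
/-- The mean curvature vector `H = ∑ B (u_i, u_i)`, where `df u_1, df u_2, …` is an orthonormal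
basis of `df (T_p L)`. -/
def meanCurvature (D : CovariantDerivative I E (fun x : M => TangentSpace I x))
    (f : L → M) (p : L) : TangentSpace I (f p) :=
  letI b := stdOrthonormalBasis ℝ (gaussMap I I' f p)
  letI u (i) : TangentSpace I' p := (LinearMap.mem_range.1 (b i).2).choose
  ∑ i, secondFundamentalForm D f p (u i) (u i)

end SecondFundamentalForm

variable (I') in
/-- `s = (e_1, …, e_n)` is a smooth lift, over the open set `U ⊆ L`, of the Gauss map of `f` to the
bundle of unitary frames of `M`: each `s q` is a unitary frame at `f q` which the projection
`(e_1, J e_1, …, e_n, J e_n) ↦ span (e_1, …, e_n)` sends to the value of the Gauss map at `q`. -/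
structure IsGaussLift (J : Π x : M, TangentSpace I x →L[ℝ] TangentSpace I x) (f : L → M) {n : ℕ}
    (U : Set L) (s : Fin n → Π q : L, TangentSpace I (f q)) : Prop where
  isOpen : IsOpen U
  smooth (i : Fin n) :
    ContMDiffOn I' I.tangent ∞ (fun q => (⟨f q, s i q⟩ : TangentBundle I M)) U
  unitary (q : L) : q ∈ U → IsUnitaryFrame J (f q) (fun i => s i q)
  lifts (q : L) : q ∈ U → Submodule.span ℝ (Set.range fun i => s i q) = gaussMap I I' f q

variable (I') in
/-- The pull-back `s^* α^i_j` of the connection 1-form of the unitary connection `D` by a local lift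
`s = (e_1, …, e_n)` to the unitary frame bundle. It is determined by `D_v e_j = ∑ α^i_j (v) e_i`,
where `(a + b i) e` stands for `a e + b J e`. -/
def connectionForm (J : Π x : M, TangentSpace I x →L[ℝ] TangentSpace I x)
    (D : CovariantDerivative I E (fun x : M => TangentSpace I x)) (f : L → M) {n : ℕ}
    (s : Fin n → Π q : L, TangentSpace I (f q)) (i j : Fin n) (p : L) (v : TangentSpace I' p) : ℂ :=
  ((inner ℝ (s i p) (covAlong I' D f (s j) p v) : ℝ) : ℂ)
    + Complex.I * ((inner ℝ (J (f p) (s i p)) (covAlong I' D f (s j) p v) : ℝ) : ℂ)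

variable (I') in
/-- The pull-back `s^* γ`, where `γ = -i ∑ α^i_i`. -/
def gammaForm (J : Π x : M, TangentSpace I x →L[ℝ] TangentSpace I x)
    (D : CovariantDerivative I E (fun x : M => TangentSpace I x)) (f : L → M) {n : ℕ}
    (s : Fin n → Π q : L, TangentSpace I (f q)) (p : L) (v : TangentSpace I' p) : ℂ :=
  -Complex.I * ∑ i, connectionForm I' J D f s i i p v

variable (I') in
/-- `μ` is the pull-back by the Gauss map `g_f` of `2 γ'`, where `γ'` is the 1-form on the bundle of
Lagrangian subspaces whose pull-back to the unitary frame bundle is `γ`: for every local lift `s`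
of `g_f` to the unitary frame bundle, `μ = g_f^* (2 γ') = 2 s^* γ`. -/
def IsMaslovForm (J : Π x : M, TangentSpace I x →L[ℝ] TangentSpace I x)
    (D : CovariantDerivative I E (fun x : M => TangentSpace I x)) (n : ℕ) (f : L → M)
    (μ : Π p : L, TangentSpace I' p →L[ℝ] ℝ) : Prop :=
  ∀ (U : Set L) (s : Fin n → Π q : L, TangentSpace I (f q)), IsGaussLift I' J f U s →
    ∀ p ∈ U, ∀ v : TangentSpace I' p, ((μ p v : ℝ) : ℂ) = 2 * gammaForm I' J D f s p v

end Submanifold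

end Ambient

end NearlyKahler

end

/-!
Write `∇` for the Levi-Civita connection. On a nearly Kähler manifold the expression `(∇_X J) Y` is
antisymmetric in `X` and `Y`, and this makes `∇_X Y - (1/2) J (∇_X J) Y` a canonical Hermitian
connection (`isCanonicalHermitian_canonicalConnection`). There is no other: the difference of two
of them is a skew-Hermitian 1-form whose torsion has the prescribed type, and such a form vanishes
(`eq_zero_of_skewHermitian_of_torsion`). Consequently the canonical connection `D` satisfies
`D_Y Y = ∇_Y Y`, `⟨J Y, D_v Y⟩ = ⟨J Y, ∇_v Y⟩` and `⟨J w, D_w Y⟩ = ⟨J w, ∇_w Y⟩`.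

For an orthonormal frame `(e_i)` of `TL`, the real part of the trace of the connection form vanishes
because the `e_i` have length one, so that `s^* γ (v) = ∑ ⟨J e_i, D_v e_i⟩`. As `L` is Lagrangian
and `J` is parallel for `D`, the `i`-th summand depends only on the value of `e_i` at the point.
Using the three identities above to pass to `∇` and back, and the symmetry of the Hessian of `f`
with respect to the torsion-free connection `∇`, it becomes `⟨J e_i, D_{e_i} V⟩` for any extension
`V` of `v` tangent to `L`. The sum of these terms is a trace, hence independent of the orthonormal
basis, and the same manipulations identify it with `⟨H, J v⟩ = -ω (H, v)`
(`IsGaussLift.sum_inner_covAlong`). This proves that `-2 L_ω (H)` is a Maslov form. It is the only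
one since the Gauss map has local lifts near every point, provided by the Gram-Schmidt process
(`IsLagrangianImmersion.exists_isGaussLift`).

If `H = 0`, then `∑ ⟨J e_i, D e_i⟩ = 0` identically. Taking the exterior derivative gives
`∑ ⟨J e_i, R e_i⟩ = 0`: the quadratic terms cancel, since the connection matrix of a unitary frame
is skew-Hermitian. The complex trace of `R` is therefore zero (`complexTrace_eq_zero`). The
curvature enters through the commutation of second covariant derivatives along `f`
(`curvature_eq_partialAlong`), which is checked in coordinates with the help of Christoffel symbols.
-/

set_option linter.unusedSectionVars false

namespace NearlyKahler

/-! ### Vector fields along a map -/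

section Along

variable {E : Type*} [NormedAddCommGroup E] [NormedSpace ℝ E] [FiniteDimensional ℝ E]
  {H : Type*} [TopologicalSpace H] {I : ModelWithCorners ℝ E H}
  {M : Type*} [TopologicalSpace M] [ChartedSpace H M] [IsManifold I ∞ M]
  {E' : Type*} [NormedAddCommGroup E'] [NormedSpace ℝ E']
  {H' : Type*} [TopologicalSpace H'] {I' : ModelWithCorners ℝ E' H'}
  {L : Type*} [TopologicalSpace L] [ChartedSpace H' L]

theorem mvfderiv_clm_comp {F G : Type*} [NormedAddCommGroup F] [NormedSpace ℝ F]
    [NormedAddCommGroup G] [NormedSpace ℝ G] (A : F →L[ℝ] G) {g : L → F} {p : L}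
    (hg : MDiffAt g p) :
    mvfderiv I' (fun q => A (g q)) p = A.comp (mvfderiv I' g p) := by
  ext v
  have := mfderiv_comp_apply (I' := 𝓘(ℝ, F)) (I'' := 𝓘(ℝ, G)) p
    (A.mdifferentiableAt (x := g p)) hg v
  rw [A.mfderiv_eq] at this
  exact this

theorem mvfderiv_comp_vector {F : Type*} [NormedAddCommGroup F] [NormedSpace ℝ F]
    {g : M → F} {f : L → M} {p : L} (hg : MDiffAt g (f p)) (hf : MDiffAt f p) :
    mvfderiv I' (fun q => g (f q)) p = (mvfderiv I g (f p)).comp (mfderiv I' I f p) :=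
  mfderiv_comp p hg hf

theorem mvfderiv_congr {F : Type*} [NormedAddCommGroup F] [NormedSpace ℝ F]
    {g g' : L → F} {p : L} (h : g =ᶠ[nhds p] g') :
    mvfderiv I' g p = mvfderiv I' g' p := by
  unfold mvfderiv
  have h1 := h.mfderiv_eq (I := I') (I' := 𝓘(ℝ, F))
  ext v
  exact congr($h1 v)

variable (I') in
/-- A vector field `s` along `f` is differentiable at `p`, as a map into the tangent bundle. -/
abbrev MDiffAlong (f : L → M) (s : Π q : L, TangentSpace I (f q)) (p : L) : Prop :=
  MDifferentiableAt I' I.tangent (fun q => (⟨f q, s q⟩ : TangentBundle I M)) p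

variable {f : L → M} {s s' : Π q : L, TangentSpace I (f q)} {p : L}

theorem trivialization_linear (t : Trivialization E (TotalSpace.proj : TangentBundle I M → M))
    [MemTrivializationAtlas t] {y : M} (hy : y ∈ t.baseSet) :
    IsLinearMap ℝ (fun v : TangentSpace I y => (t ⟨y, v⟩).2) :=
  t.linear ℝ hy

theorem symmL_apply_apply (t : Trivialization E (TotalSpace.proj : TangentBundle I M → M))
    [MemTrivializationAtlas t] {y : M} (hy : y ∈ t.baseSet) (v : TangentSpace I y) :
    t.symmL ℝ y (t ⟨y, v⟩).2 = v := by
  rw [t.symmL_apply hy]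
  exact t.symm_apply_apply_mk hy v

theorem apply_symmL (t : Trivialization E (TotalSpace.proj : TangentBundle I M → M))
    [MemTrivializationAtlas t] {y : M} (hy : y ∈ t.baseSet) (w : E) :
    (t ⟨y, t.symmL ℝ y w⟩).2 = w := by
  rw [t.symmL_apply hy, t.apply_mk_symm hy]

theorem mdiffAlong_iff (t : Trivialization E (TotalSpace.proj : TangentBundle I M → M))
    [MemTrivializationAtlas t] (ht : f p ∈ t.baseSet) :
    MDiffAlong I' f s p ↔
      MDifferentiableAt I' I f p ∧ MDiffAt (fun q => (t ⟨f q, s q⟩).2) p :=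
  t.mdifferentiableAt_totalSpace_iff (IB := I) (IM := I')
    (fun q => (⟨f q, s q⟩ : TangentBundle I M)) (t.mem_source.2 ht)

theorem MDiffAlong.base (hs : MDiffAlong I' f s p) : MDifferentiableAt I' I f p :=
  ((mdiffAlong_iff (trivializationAt E (TangentSpace I) (f p))
    (FiberBundle.mem_baseSet_trivializationAt' (f p))).1 hs).1

theorem eventually_mem_baseSet (t : Trivialization E (TotalSpace.proj : TangentBundle I M → M))
    (ht : f p ∈ t.baseSet) (hf : ContinuousAt f p) : ∀ᶠ q in nhds p, f q ∈ t.baseSet :=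
  hf.eventually_mem (t.open_baseSet.mem_nhds ht)

theorem MDiffAlong.congr (hs : MDiffAlong I' f s p) (h : ∀ᶠ q in nhds p, s' q = s q) :
    MDiffAlong I' f s' p :=
  MDifferentiableAt.congr_of_eventuallyEq hs (h.mono fun q hq => by simp [hq])

theorem MDiffAlong.add (hs : MDiffAlong I' f s p) (hs' : MDiffAlong I' f s' p) :
    MDiffAlong I' f (fun q => s q + s' q) p := by
  have hf := hs.base
  let t := trivializationAt E (TangentSpace I) (f p)
  have ht : f p ∈ t.baseSet := FiberBundle.mem_baseSet_trivializationAt' (f p)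
  rw [mdiffAlong_iff t ht] at hs hs' ⊢
  refine ⟨hf, (hs.2.add hs'.2).congr_of_eventuallyEq ?_⟩
  filter_upwards [eventually_mem_baseSet t ht hf.continuousAt] with q hq
  exact (trivialization_linear t hq).map_add _ _

theorem MDiffAlong.smul {c : L → ℝ} (hc : MDiffAt c p) (hs : MDiffAlong I' f s p) :
    MDiffAlong I' f (fun q => c q • s q) p := by
  have hf := hs.base
  let t := trivializationAt E (TangentSpace I) (f p)
  have ht : f p ∈ t.baseSet := FiberBundle.mem_baseSet_trivializationAt' (f p)
  rw [mdiffAlong_iff t ht] at hs ⊢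
  refine ⟨hf, (hc.smul hs.2).congr_of_eventuallyEq ?_⟩
  filter_upwards [eventually_mem_baseSet t ht hf.continuousAt] with q hq
  exact (trivialization_linear t hq).map_smul _ _

theorem mdiffAlong_comp {Y : Π y : M, TangentSpace I y} (hY : MDiffAt (T% Y) (f p))
    (hf : MDifferentiableAt I' I f p) : MDiffAlong I' f (fun q => Y (f q)) p :=
  MDifferentiableAt.comp (I' := I) p (g := fun y => (⟨y, Y y⟩ : TangentBundle I M)) hY hf

/-- A property of vector fields along `f` which is local, additive and compatible with
multiplication by functions holds for all differentiable fields as soon as it holds for the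
restrictions `Y ∘ f` of ambient fields: in a local frame `(E_k)`, `s = ∑ s^k (E_k ∘ f)`. -/
theorem along_induction {P : (Π q : L, TangentSpace I (f q)) → Prop}
    (comp : ∀ Y : Π y : M, TangentSpace I y, MDiffAt (T% Y) (f p) → P (fun q => Y (f q)))
    (add : ∀ s s', MDiffAlong I' f s p → MDiffAlong I' f s' p → P s → P s' →
      P (fun q => s q + s' q))
    (smul : ∀ (c : L → ℝ) s, MDiffAt c p → MDiffAlong I' f s p → P s → P (fun q => c q • s q))
    (congr : ∀ s s', MDiffAlong I' f s p → (∀ᶠ q in nhds p, s' q = s q) → P s → P s')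
    (hs : MDiffAlong I' f s p) : P s := by
  have hf := hs.base
  let t := trivializationAt E (TangentSpace I) (f p)
  have ht : f p ∈ t.baseSet := FiberBundle.mem_baseSet_trivializationAt' (f p)
  let b := Module.finBasis ℝ E
  let c (k) (q : L) : ℝ := b.repr (t ⟨f q, s q⟩).2 k
  have hc (k) : MDiffAt (c k) p := by
    have h := ((mdiffAlong_iff t ht).1 hs).2
    let A : E →L[ℝ] ℝ := (b.coord k).toContinuousLinearMap
    exact (A.mdifferentiableAt (x := (t ⟨f p, s p⟩).2)).comp p h
  have hE (k) : MDiffAt (T% (t.localFrame b k)) (f p) :=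
    (contMDiffAt_localFrame_of_mem 1 _ b k ht).mdifferentiableAt (by simp)
  have key (S : Finset (Fin (Module.finrank ℝ E))) :
      MDiffAlong I' f (fun q => ∑ k ∈ S, c k q • t.localFrame b k (f q)) p ∧
        P (fun q => ∑ k ∈ S, c k q • t.localFrame b k (f q)) := by
    classical
    induction S using Finset.induction_on with
    | empty =>
      have h0 : MDiffAt (T% (0 : Π y : M, TangentSpace I y)) (f p) :=
        mdifferentiableAt_zeroSection ..
      exact ⟨by simpa using! mdiffAlong_comp h0 hf, by simpa using! comp _ h0⟩
    | insert a S ha ih =>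
      simp only [Finset.sum_insert ha]
      have h1 := mdiffAlong_comp (hE a) hf
      exact ⟨((h1.smul (hc a)).add ih.1),
        add _ _ (h1.smul (hc a)) ih.1 (smul _ _ (hc a) h1 (comp _ (hE a))) ih.2⟩
  refine congr _ _ (key Finset.univ).1 ?_ (key Finset.univ).2
  filter_upwards [eventually_mem_baseSet t ht hf.continuousAt] with q hq
  have h3 : t.symmL ℝ (f q) (t ⟨f q, s q⟩).2 = s q := symmL_apply_apply t hq (s q)
  rw [← h3, ← b.sum_repr (t ⟨f q, s q⟩).2, map_sum]
  refine Finset.sum_congr rfl fun k _ => ?_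
  rw [map_smul, t.localFrame_apply_of_mem_baseSet b hq]
  simp [Trivialization.basisAt, c, Trivialization.symmL_apply, hq]

end Along

/-! ### Connections in a trivialization and pull-back connections -/

section Local

variable {E : Type*} [NormedAddCommGroup E] [NormedSpace ℝ E] [FiniteDimensional ℝ E]
  {H : Type*} [TopologicalSpace H] {I : ModelWithCorners ℝ E H}
  {M : Type*} [TopologicalSpace M] [ChartedSpace H M] [IsManifold I ∞ M]
  {E' : Type*} [NormedAddCommGroup E'] [NormedSpace ℝ E']
  {H' : Type*} [TopologicalSpace H'] {I' : ModelWithCorners ℝ E' H'}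
  {L : Type*} [TopologicalSpace L] [ChartedSpace H' L]

/-- The vector field which is constantly equal to `w` in the trivialization `t`. -/
noncomputable def localField (t : Trivialization E (TotalSpace.proj : TangentBundle I M → M))
    [MemTrivializationAtlas t] (w : E) : Π y : M, TangentSpace I y :=
  fun y => t.symmL ℝ y w

variable {t t' : Trivialization E (TotalSpace.proj : TangentBundle I M → M)}
  [MemTrivializationAtlas t] [MemTrivializationAtlas t']

theorem localField_eq_self {x : M} (hx : x ∈ t.baseSet) (v : TangentSpace I x) :
    localField t (t ⟨x, v⟩).2 x = v :=
  symmL_apply_apply t hx v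

theorem apply_localField {x : M} (hx : x ∈ t.baseSet) (w : E) :
    (t ⟨x, localField t w x⟩).2 = w :=
  apply_symmL t hx w

theorem localField_add (w w' : E) : localField t (w + w') = localField t w + localField t w' := by
  ext y; simp [localField]

theorem localField_smul (c : ℝ) (w : E) : localField t (c • w) = c • localField t w := by
  ext y; simp [localField]

/-- The extension `FiberBundle.extend E v` takes arbitrary values outside the base set of the
trivialization, so that it agrees with the locally constant field only near `x`. -/
theorem extend_eventuallyEq_localField {x : M} (v : TangentSpace I x) :
    ∀ᶠ y in nhds x, (FiberBundle.extend E v : Π y : M, TangentSpace I y) y =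
      localField (trivializationAt E (TangentSpace I) x)
        (trivializationAt E (TangentSpace I) x ⟨x, v⟩).2 y := by
  filter_upwards [(trivializationAt E (TangentSpace I) x).open_baseSet.mem_nhds
    (FiberBundle.mem_baseSet_trivializationAt' x)] with y hy
  simp only [localField, Trivialization.symmL_apply _ hy]
  rfl

theorem contMDiffAt_localField {x : M} (hx : x ∈ t.baseSet) (w : E) :
    CMDiffAt ∞ (T% (localField t w)) x := by
  rw [t.contMDiffAt_section_iff hx]
  refine (contMDiffAt_const (c := w)).congr_of_eventuallyEq ?_
  filter_upwards [t.open_baseSet.mem_nhds hx] with y hy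
  exact apply_localField hy w

theorem mdifferentiableAt_localField {x : M} (hx : x ∈ t.baseSet) (w : E) :
    MDiffAt (T% (localField t w)) x :=
  (contMDiffAt_localField hx w).mdifferentiableAt (by simp)

variable (D : CovariantDerivative I E (fun x : M => TangentSpace I x))

theorem cov_add {Y Z : Π y : M, TangentSpace I y} {x : M} (hY : MDiffAt (T% Y) x)
    (hZ : MDiffAt (T% Z) x) : D (Y + Z) x = D Y x + D Z x :=
  D.isCovariantDerivativeOnUniv.add hY hZ

theorem cov_smul {Y : Π y : M, TangentSpace I y} {x : M} (c : ℝ) (hY : MDiffAt (T% Y) x) :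
    D (c • Y) x = c • D Y x :=
  D.isCovariantDerivativeOnUniv.smul_const c hY

theorem cov_congr {Y Z : Π y : M, TangentSpace I y} {x : M} (hY : MDiffAt (T% Y) x)
    (hZ : MDiffAt (T% Z) x) (h : ∀ᶠ y in nhds x, Y y = Z y) : D Y x = D Z x :=
  D.isCovariantDerivativeOnUniv.congr_of_eventuallyEq hY hZ Filter.univ_mem h

/-- A connection in a trivialization: it differs from the trivial connection by a zeroth-order
term. -/
theorem cov_eq_local {x : M} (hx : x ∈ t.baseSet) {Y : Π y : M, TangentSpace I y}
    (hY : MDiffAt (T% Y) x) :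
    D Y x = (t.symmL ℝ x).comp (mvfderiv I (fun y => (t ⟨y, Y y⟩).2) x)
      + D (localField t (t ⟨x, Y x⟩).2) x := by
  have hread {Z : Π y : M, TangentSpace I y} (hZ : MDiffAt (T% Z) x) :
      MDiffAt (fun y => (t ⟨y, Z y⟩).2) x :=
    (t.mdifferentiableAt_section_iff I Z hx).1 hZ
  have hev := t.open_baseSet.mem_nhds hx
  let Φ (Z : Π y : M, TangentSpace I y) : TangentSpace I x →L[ℝ] TangentSpace I x :=
    D Z x - (t.symmL ℝ x).comp (mvfderiv I (fun y => (t ⟨y, Z y⟩).2) x)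
  -- The difference of `D` and the trivial connection is tensorial, so that it can be evaluated on
  -- the locally constant field with the same value, which the trivial connection kills.
  have hΦ : TensorialAt I E Φ x := by
    constructor
    · intro c Z hc hZ
      have h1 : mvfderiv I (fun y => (t ⟨y, (c • Z) y⟩).2) x
          = c x • mvfderiv I (fun y => (t ⟨y, Z y⟩).2) x
            + (mvfderiv I c x).smulRight (t ⟨x, Z x⟩).2 := by
        rw [← mvfderiv_fun_smul hc (hread hZ)]
        refine mvfderiv_congr ?_
        filter_upwards [hev] with y hy
        exact (trivialization_linear t hy).map_smul _ _
      ext v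
      simp only [Φ, h1, D.isCovariantDerivativeOnUniv.leibniz hZ hc]
      simp [symmL_apply_apply t hx]
      module
    · intro Z Z' hZ hZ'
      have h1 : mvfderiv I (fun y => (t ⟨y, (Z + Z') y⟩).2) x
          = mvfderiv I (fun y => (t ⟨y, Z y⟩).2) x
            + mvfderiv I (fun y => (t ⟨y, Z' y⟩).2) x := by
        rw [← mvfderiv_fun_add (hread hZ) (hread hZ')]
        refine mvfderiv_congr ?_
        filter_upwards [hev] with y hy
        exact (trivialization_linear t hy).map_add _ _
      ext v
      simp only [Φ, h1, D.isCovariantDerivativeOnUniv.add hZ hZ']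
      simp
      module
  have hloc := mdifferentiableAt_localField hx (t ⟨x, Y x⟩).2
  have h2 : Φ Y = Φ (localField t (t ⟨x, Y x⟩).2) :=
    hΦ.pointwise hY hloc (localField_eq_self hx _).symm
  have h3 : mvfderiv I (fun y => (t ⟨y, localField t (t ⟨x, Y x⟩).2 y⟩).2) x = 0 := by
    rw [← mvfderiv_const (I := I) (t ⟨x, Y x⟩).2 (x := x)]
    refine mvfderiv_congr ?_
    filter_upwards [hev] with y hy
    exact apply_localField hy _
  simp only [Φ, h3, ContinuousLinearMap.comp_zero, sub_zero] at h2
  rw [← h2]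
  abel

variable (I') (t) in
/-- The covariant derivative of a vector field along `f`, computed in the trivialization `t`; the
definition of `covAlong` uses the preferred trivialization around `f p`. -/
noncomputable def covAlongIn (f : L → M) (s : Π q : L, TangentSpace I (f q)) (p : L) :
    TangentSpace I' p →L[ℝ] TangentSpace I (f p) :=
  (t.symmL ℝ (f p)).comp (mvfderiv I' (fun q => (t ⟨f q, s q⟩).2) p)
    + (D (localField t (t ⟨f p, s p⟩).2) (f p)).comp (mfderiv I' I f p)

variable {D} {f : L → M} {s s' : Π q : L, TangentSpace I (f q)} {p : L}

theorem covAlong_eq_covAlongIn :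
    covAlong I' D f s p
      = covAlongIn I' (trivializationAt E (TangentSpace I) (f p)) D f s p := by
  have hx := FiberBundle.mem_baseSet_trivializationAt' (F := E)
    (E := fun x : M => TangentSpace I x) (f p)
  unfold covAlong covAlongIn
  rw [cov_congr D (FiberBundle.mdifferentiableAt_extend ..) (mdifferentiableAt_localField hx _)
    (extend_eventuallyEq_localField (s p))]

theorem covAlongIn_congr (h : ∀ᶠ q in nhds p, s q = s' q) :
    covAlongIn I' t D f s p = covAlongIn I' t D f s' p := by
  unfold covAlongIn
  rw [h.self_of_nhds, mvfderiv_congr (g' := fun q => (t ⟨f q, s' q⟩).2)]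
  filter_upwards [h] with q hq
  rw [hq]

theorem covAlongIn_add (ht : f p ∈ t.baseSet) (hs : MDiffAlong I' f s p)
    (hs' : MDiffAlong I' f s' p) :
    covAlongIn I' t D f (fun q => s q + s' q) p
      = covAlongIn I' t D f s p + covAlongIn I' t D f s' p := by
  unfold covAlongIn
  have h1 : mvfderiv I' (fun q => (t ⟨f q, s q + s' q⟩).2) p
      = mvfderiv I' (fun q => (t ⟨f q, s q⟩).2) p + mvfderiv I' (fun q => (t ⟨f q, s' q⟩).2) p := by
    rw [← mvfderiv_fun_add ((mdiffAlong_iff t ht).1 hs).2 ((mdiffAlong_iff t ht).1 hs').2]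
    refine mvfderiv_congr ?_
    filter_upwards [eventually_mem_baseSet t ht hs.base.continuousAt] with q hq
    exact (trivialization_linear t hq).map_add _ _
  rw [h1, (trivialization_linear t ht).map_add, localField_add,
    cov_add D (mdifferentiableAt_localField ht _) (mdifferentiableAt_localField ht _)]
  ext v
  simp
  abel

theorem covAlongIn_smul (ht : f p ∈ t.baseSet) {c : L → ℝ} (hc : MDiffAt c p)
    (hs : MDiffAlong I' f s p) :
    covAlongIn I' t D f (fun q => c q • s q) p
      = c p • covAlongIn I' t D f s p + (mvfderiv I' c p).smulRight (s p) := by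
  unfold covAlongIn
  have h1 : mvfderiv I' (fun q => (t ⟨f q, c q • s q⟩).2) p
      = c p • mvfderiv I' (fun q => (t ⟨f q, s q⟩).2) p
        + (mvfderiv I' c p).smulRight (t ⟨f p, s p⟩).2 := by
    rw [← mvfderiv_fun_smul hc ((mdiffAlong_iff t ht).1 hs).2]
    refine mvfderiv_congr ?_
    filter_upwards [eventually_mem_baseSet t ht hs.base.continuousAt] with q hq
    exact (trivialization_linear t hq).map_smul _ _
  rw [h1, (trivialization_linear t ht).map_smul, localField_smul,
    cov_smul D _ (mdifferentiableAt_localField ht _)]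
  ext v
  simp [symmL_apply_apply t ht]
  module

theorem covAlongIn_comp (ht : f p ∈ t.baseSet) (hf : MDifferentiableAt I' I f p)
    {Y : Π y : M, TangentSpace I y} (hY : MDiffAt (T% Y) (f p)) :
    covAlongIn I' t D f (fun q => Y (f q)) p = (D Y (f p)).comp (mfderiv I' I f p) := by
  rw [cov_eq_local D ht hY]
  unfold covAlongIn
  rw [mvfderiv_comp_vector (g := fun y => (t ⟨y, Y y⟩).2)
    ((t.mdifferentiableAt_section_iff I Y ht).1 hY) hf]
  ext v
  simp

/-- The covariant derivative along `f` can be computed in any trivialization around `f p`. -/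
theorem covAlong_eq_covAlongIn_of_mem (ht : f p ∈ t.baseSet) (hs : MDiffAlong I' f s p) :
    covAlong I' D f s p = covAlongIn I' t D f s p := by
  rw [covAlong_eq_covAlongIn]
  have ht₀ : f p ∈ (trivializationAt E (TangentSpace I) (f p)).baseSet :=
    FiberBundle.mem_baseSet_trivializationAt' (f p)
  refine along_induction (P := fun s => covAlongIn I' (trivializationAt E (TangentSpace I) (f p))
    D f s p = covAlongIn I' t D f s p) ?_ ?_ ?_ ?_ hs
  · intro Y hY
    rw [covAlongIn_comp ht₀ hs.base hY, covAlongIn_comp ht hs.base hY]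
  · intro s s' hs hs' h h'
    rw [covAlongIn_add ht₀ hs hs', covAlongIn_add ht hs hs', h, h']
  · intro c s hc hs h
    rw [covAlongIn_smul ht₀ hc hs, covAlongIn_smul ht hc hs, h]
  · intro s s' _ hss' h
    rw [covAlongIn_congr hss', covAlongIn_congr hss', h]

theorem covAlong_congr (h : ∀ᶠ q in nhds p, s q = s' q) :
    covAlong I' D f s p = covAlong I' D f s' p := by
  rw [covAlong_eq_covAlongIn, covAlong_eq_covAlongIn, covAlongIn_congr h]

theorem covAlong_add (hs : MDiffAlong I' f s p) (hs' : MDiffAlong I' f s' p) :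
    covAlong I' D f (fun q => s q + s' q) p = covAlong I' D f s p + covAlong I' D f s' p := by
  simp only [covAlong_eq_covAlongIn]
  exact covAlongIn_add (FiberBundle.mem_baseSet_trivializationAt' (f p)) hs hs'

theorem covAlong_smul {c : L → ℝ} (hc : MDiffAt c p) (hs : MDiffAlong I' f s p) :
    covAlong I' D f (fun q => c q • s q) p
      = c p • covAlong I' D f s p + (mvfderiv I' c p).smulRight (s p) := by
  simp only [covAlong_eq_covAlongIn]
  exact covAlongIn_smul (FiberBundle.mem_baseSet_trivializationAt' (f p)) hc hs

/-- The chain rule: `D_v (Y ∘ f) = D_{df v} Y`. -/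
theorem covAlong_comp (hf : MDifferentiableAt I' I f p)
    {Y : Π y : M, TangentSpace I y} (hY : MDiffAt (T% Y) (f p)) :
    covAlong I' D f (fun q => Y (f q)) p = (D Y (f p)).comp (mfderiv I' I f p) := by
  rw [covAlong_eq_covAlongIn]
  exact covAlongIn_comp (FiberBundle.mem_baseSet_trivializationAt' (f p)) hf hY

end Local

section Riemannian

variable {E : Type*} [NormedAddCommGroup E] [NormedSpace ℝ E] [FiniteDimensional ℝ E]
  {H : Type*} [TopologicalSpace H] {I : ModelWithCorners ℝ E H}
  {M : Type*} [TopologicalSpace M] [ChartedSpace H M] [IsManifold I ∞ M]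
  [RiemannianBundle (fun x : M => TangentSpace I x)]
  [IsContMDiffRiemannianBundle I ∞ E (fun x : M => TangentSpace I x)]
  {E' : Type*} [NormedAddCommGroup E'] [NormedSpace ℝ E']
  {H' : Type*} [TopologicalSpace H'] {I' : ModelWithCorners ℝ E' H'}
  {L : Type*} [TopologicalSpace L] [ChartedSpace H' L]
  {D : CovariantDerivative I E (fun x : M => TangentSpace I x)}
  {J : Π x : M, TangentSpace I x →L[ℝ] TangentSpace I x}
  {f : L → M} {s s' : Π q : L, TangentSpace I (f q)} {p : L}

theorem MDiffAlong.inner (hs : MDiffAlong I' f s p) (hs' : MDiffAlong I' f s' p) :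
    MDiffAt (fun q => (inner ℝ (s q) (s' q) : ℝ)) p :=
  MDifferentiableAt.inner_bundle (IB := I) (E := fun x : M => TangentSpace I x) hs hs'

/-- The Leibniz rule `d ⟨s, s'⟩ = ⟨D s, s'⟩ + ⟨s, D s'⟩` for vector fields along a map and a metric
connection. -/
theorem IsMetric.covAlong (hD : IsMetric D) (hs : MDiffAlong I' f s p)
    (hs' : MDiffAlong I' f s' p) (v : TangentSpace I' p) :
    mvfderiv I' (fun q => (inner ℝ (s q) (s' q) : ℝ)) p v
      = inner ℝ (covAlong I' D f s p v) (s' p) + inner ℝ (s p) (covAlong I' D f s' p v) := by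
  refine along_induction (P := fun s => mvfderiv I' (fun q => (inner ℝ (s q) (s' q) : ℝ)) p v
      = inner ℝ (NearlyKahler.covAlong I' D f s p v) (s' p)
        + inner ℝ (s p) (NearlyKahler.covAlong I' D f s' p v)) ?_ ?_ ?_ ?_ hs
  · intro Y hY
    refine along_induction (P := fun s' =>
      mvfderiv I' (fun q => (inner ℝ (Y (f q)) (s' q) : ℝ)) p v
        = inner ℝ (NearlyKahler.covAlong I' D f (fun q => Y (f q)) p v) (s' p)
        + inner ℝ (Y (f p)) (NearlyKahler.covAlong I' D f s' p v)) ?_ ?_ ?_ ?_ hs'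
    · intro Z hZ
      rw [covAlong_comp hs.base hY, covAlong_comp hs.base hZ]
      have := hD (f p) Y Z (mfderiv I' I f p v) hY hZ
      rw [mvfderiv_comp_vector (g := fun y => (inner ℝ (Y y) (Z y) : ℝ))
        (MDifferentiableAt.inner_bundle (IB := I) (E := fun x : M => TangentSpace I x) hY hZ)
        hs.base]
      exact this
    · intro s s' hs hs' h h'
      have hY' := mdiffAlong_comp hY hs.base
      rw [covAlong_add hs hs']
      simp only [inner_add_right]
      rw [mvfderiv_fun_add (hY'.inner hs) (hY'.inner hs')]
      simp only [add_apply, inner_add_right]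
      linear_combination h + h'
    · intro c s hc hs h
      have hY' := mdiffAlong_comp hY hs.base
      rw [covAlong_smul hc hs]
      simp only [inner_smul_right]
      rw [mvfderiv_fun_mul hc (hY'.inner hs)]
      simp only [add_apply, inner_add_right, smul_apply,
        inner_smul_right, ContinuousLinearMap.smulRight_apply, smul_eq_mul]
      linear_combination c p * h
    · intro s s' _ hss' h
      rw [covAlong_congr hss', hss'.self_of_nhds, ← h]
      refine congr($(mvfderiv_congr ?_) v)
      filter_upwards [hss'] with q hq
      rw [hq]
  · intro s₁ s₂ h₁ h₂ h h'
    rw [covAlong_add h₁ h₂]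
    simp only [inner_add_left]
    rw [mvfderiv_fun_add (h₁.inner hs') (h₂.inner hs')]
    simp only [add_apply, inner_add_left]
    linear_combination h + h'
  · intro c s hc hs h
    rw [covAlong_smul hc hs]
    simp only [real_inner_smul_left]
    rw [mvfderiv_fun_mul hc (hs.inner hs')]
    simp only [add_apply, inner_add_left, smul_apply,
      real_inner_smul_left, ContinuousLinearMap.smulRight_apply, smul_eq_mul]
    linear_combination c p * h
  · intro s₁ s₂ _ hss' h
    rw [covAlong_congr hss', hss'.self_of_nhds, ← h]
    refine congr($(mvfderiv_congr ?_) v)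
    filter_upwards [hss'] with q hq
    rw [hq]

theorem IsAlmostHermitian.mdiffAt_apply (hJ : IsAlmostHermitian J) {x : M}
    {Y : Π y : M, TangentSpace I y} (hY : MDiffAt (T% Y) x) :
    MDiffAt (T% (fun y => J y (Y y))) x :=
  MDifferentiableAt.clm_bundle_apply ((hJ.smooth x).mdifferentiableAt (by simp)) hY

theorem IsAlmostHermitian.mdiffAlong (hJ : IsAlmostHermitian J) (hs : MDiffAlong I' f s p) :
    MDiffAlong I' f (fun q => J (f q) (s q)) p :=
  MDifferentiableAt.clm_bundle_apply (b := f) (F₁ := E) (F₂ := E)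
    (E₁ := fun x : M => TangentSpace I x) (E₂ := fun x : M => TangentSpace I x) (IB := I)
    (ϕ := fun q => J (f q)) (MDifferentiableAt.comp (I' := I) p
      (g := fun x => TotalSpace.mk' (E →L[ℝ] E)
        (E := fun x : M => TangentSpace I x →L[ℝ] TangentSpace I x) x (J x))
      ((hJ.smooth (f p)).mdifferentiableAt (by simp)) hs.base) hs

/-- If `∇ J = 0`, then also the covariant derivative along a map commutes with `J`. -/
theorem covAlong_apply_of_parallel (hJ : IsAlmostHermitian J)
    (hD : ∀ (x : M) (Y : Π y : M, TangentSpace I y) (v : TangentSpace I x),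
      MDiffAt (T% Y) x → D (fun y => J y (Y y)) x v = J x (D Y x v))
    (hs : MDiffAlong I' f s p) (v : TangentSpace I' p) :
    covAlong I' D f (fun q => J (f q) (s q)) p v = J (f p) (covAlong I' D f s p v) := by
  refine along_induction (P := fun s => covAlong I' D f (fun q => J (f q) (s q)) p v
    = J (f p) (covAlong I' D f s p v)) ?_ ?_ ?_ ?_ hs
  · intro Y hY
    rw [covAlong_comp hs.base hY,
      covAlong_comp (Y := fun y => J y (Y y)) hs.base (hJ.mdiffAt_apply hY)]
    exact hD _ _ _ hY
  · intro s s' hs hs' h h'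
    simp only [map_add]
    rw [covAlong_add hs hs', covAlong_add (hJ.mdiffAlong hs) (hJ.mdiffAlong hs')]
    simp [h, h']
  · intro c s hc hs h
    simp only [map_smul]
    rw [covAlong_smul hc hs, covAlong_smul hc (hJ.mdiffAlong hs)]
    simp [h]
  · intro s s' _ hss' h
    rw [covAlong_congr hss', ← h, covAlong_congr]
    filter_upwards [hss'] with q hq
    rw [hq]

end Riemannian

/-! ### The canonical Hermitian connection -/

section Canonical

/-- A skew-Hermitian endomorphism-valued 1-form `B` whose torsion `B Y X - B X Y` satisfies
`T (J X, Y) = T (X, J Y)` vanishes. Here `B Y X` is the value at `Y` of the endomorphism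
corresponding to `X`. -/
theorem eq_zero_of_skewHermitian_of_torsion {V : Type*} [NormedAddCommGroup V]
    [InnerProductSpace ℝ V] {J : V → V} (hsq : ∀ v, J (J v) = -v)
    (hadd : ∀ v w, J (v + w) = J v + J w) (hneg : ∀ v, J (-v) = -J v)
    (hskew : ∀ v w, inner ℝ (J v) w = -inner ℝ v (J w))
    {B : V → V → V} (hBneg : ∀ v w, B v (-w) = -B v w)
    (hB : ∀ w v z, inner ℝ (B w v) z + inner ℝ w (B z v) = 0)
    (hBJ : ∀ w v, B (J w) v = J (B w v))
    (hT : ∀ u v, B v (J u) - B (J u) v = B (J v) u - B u (J v)) (w v : V) : B w v = 0 := by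
  -- The defect of complex linearity in the form argument.
  let C (X Y : V) : V := B Y (J X) - J (B Y X)
  have hsub (v w : V) : J (v - w) = J v - J w := by rw [sub_eq_add_neg, hadd, hneg, sub_eq_add_neg]
  have hCanti (X Y : V) : C X Y = -C Y X := by
    have := hT X Y
    rw [hBJ, hBJ] at this
    simp only [C]
    linear_combination (norm := module) this
  have hC1 (X Y : V) : C (J X) Y = -J (C X Y) := by
    simp only [C, hsq, hBneg, hsub]
    abel
  have hC2 (X Y : V) : C X (J Y) = J (C X Y) := by
    simp only [C, hBJ, hsub]
  have hC (X Y : V) : C X Y = 0 := by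
    have h1 : J (C X Y) = -J (C X Y) := by
      rw [← hC1, hCanti (J X), hC2, hCanti Y X, hneg, neg_neg]
    have h2 : J (C X Y) = 0 := by
      have : (2 : ℝ) • J (C X Y) = 0 := by linear_combination (norm := module) h1
      simpa using this
    have h3 := hsq (C X Y)
    rw [h2] at h3
    have h0 : J 0 = 0 := by simpa using hadd 0 0
    rw [h0] at h3
    exact neg_eq_zero.1 h3.symm
  have hlin (X Y : V) : B Y (J X) = J (B Y X) := sub_eq_zero.1 (hC X Y)
  -- `B` is complex linear in both arguments, so that skewness for `X` against `J Z` and for `J X`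
  -- against `Z` give the same inner products with opposite signs.
  have key (X Y Z : V) : inner ℝ (B Y (J X)) Z = 0 := by
    have h1 := hB Y X (J Z)
    have h2 := hB Y (J X) Z
    rw [hBJ, ← hlin] at h1
    have h3 : inner ℝ (B Y (J X)) Z = -inner ℝ (B Y X) (J Z) := by rw [hlin, hskew]
    linarith
  have h4 : B w (J v) = 0 := by
    rw [← inner_self_eq_zero (𝕜 := ℝ)]
    exact key v w _
  rw [hlin] at h4
  have h3 := hsq (B w v)
  have h0 : J 0 = 0 := by simpa using hadd 0 0
  rw [h4, h0] at h3
  exact neg_eq_zero.1 h3.symm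

variable {E : Type*} [NormedAddCommGroup E] [NormedSpace ℝ E] [FiniteDimensional ℝ E]
  {H : Type*} [TopologicalSpace H] {I : ModelWithCorners ℝ E H}
  {M : Type*} [TopologicalSpace M] [ChartedSpace H M] [IsManifold I ∞ M]
  [RiemannianBundle (fun x : M => TangentSpace I x)]
  [IsContMDiffRiemannianBundle I ∞ E (fun x : M => TangentSpace I x)]
  {J : Π x : M, TangentSpace I x →L[ℝ] TangentSpace I x}
  {D D₁ : CovariantDerivative I E (fun x : M => TangentSpace I x)}

theorem IsAlmostHermitian.inner_left (hJ : IsAlmostHermitian J) {x : M} (v w : TangentSpace I x) :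
    (inner ℝ (J x v) w : ℝ) = -inner ℝ v (J x w) := by
  rw [← hJ.orthogonal x v (J x w), hJ.sq, inner_neg_right, neg_neg]

theorem IsAlmostHermitian.inner_self (hJ : IsAlmostHermitian J) {x : M} (v : TangentSpace I x) :
    (inner ℝ v (J x v) : ℝ) = 0 := by
  have h1 := hJ.inner_left v v
  have h2 := real_inner_comm v (J x v)
  linarith

theorem contMDiff_comp_endomorphism {A B : Π x : M, TangentSpace I x →L[ℝ] TangentSpace I x}
    (hA : ContMDiff I (I.prod 𝓘(ℝ, E →L[ℝ] E)) ∞ (fun x => TotalSpace.mk' (E →L[ℝ] E)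
      (E := fun x : M => TangentSpace I x →L[ℝ] TangentSpace I x) x (A x)))
    (hB : ContMDiff I (I.prod 𝓘(ℝ, E →L[ℝ] E)) ∞ (fun x => TotalSpace.mk' (E →L[ℝ] E)
      (E := fun x : M => TangentSpace I x →L[ℝ] TangentSpace I x) x (B x))) :
    ContMDiff I (I.prod 𝓘(ℝ, E →L[ℝ] E)) ∞ (fun x => TotalSpace.mk' (E →L[ℝ] E)
      (E := fun x : M => TangentSpace I x →L[ℝ] TangentSpace I x) x ((A x).comp (B x))) := by
  intro x
  have hA' := (contMDiffAt_hom_bundle _).1 (hA x)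
  have hB' := (contMDiffAt_hom_bundle _).1 (hB x)
  refine (contMDiffAt_hom_bundle _).2 ⟨contMDiffAt_id, ?_⟩
  refine (hA'.2.clm_comp hB'.2).congr_of_eventuallyEq ?_
  filter_upwards [(trivializationAt E (TangentSpace I) x).open_baseSet.mem_nhds
    (FiberBundle.mem_baseSet_trivializationAt' x)] with y hy
  ext v
  simp only [ContinuousLinearMap.inCoordinates, ContinuousLinearMap.comp_apply]
  rw [Trivialization.symmL_continuousLinearMapAt _ hy]

theorem cov_neg {Y : Π y : M, TangentSpace I y} {x : M} (hY : MDiffAt (T% Y) x) :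
    D (fun y => -Y y) x = -D Y x := by
  have := cov_smul D (-1) hY
  rw [neg_one_smul, neg_one_smul] at this
  exact this

/-- The connection `∇_X Y - (1/2) J (∇_X J) Y`, written as `(1/2) (∇_X Y - J ∇_X (J Y))`. When `D`
is the Levi-Civita connection of a nearly Kähler manifold, this is the canonical Hermitian
connection. -/
noncomputable def canonicalConnection (hJ : IsAlmostHermitian J)
    (D : CovariantDerivative I E (fun x : M => TangentSpace I x)) :
    CovariantDerivative I E (fun x : M => TangentSpace I x) where
  toFun Y x := (1 / 2 : ℝ) • (D Y x - (J x).comp (D (fun y => J y (Y y)) x))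
  isCovariantDerivativeOnUniv := by
    constructor
    · intro Y Z x hY hZ _
      have h := cov_add D (hJ.mdiffAt_apply hY) (hJ.mdiffAt_apply hZ)
      have h' : (fun y => J y ((Y + Z) y)) = (fun y => J y (Y y)) + fun y => J y (Z y) := by
        ext y; simp
      rw [h', h, cov_add D hY hZ]
      ext v
      simp
      module
    · intro Y c x hY hc _
      have h := D.isCovariantDerivativeOnUniv.leibniz (hJ.mdiffAt_apply hY) hc
      have h' : (fun y => J y ((c • Y) y)) = c • fun y => J y (Y y) := by
        ext y; simp
      rw [h', h, D.isCovariantDerivativeOnUniv.leibniz hY hc]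
      ext v
      simp [hJ.sq]
      module

theorem canonicalConnection_apply (hJ : IsAlmostHermitian J) (Y : Π y : M, TangentSpace I y)
    (x : M) (v : TangentSpace I x) :
    canonicalConnection hJ D Y x v
      = (1 / 2 : ℝ) • (D Y x v - J x (D (fun y => J y (Y y)) x v)) := rfl

theorem IsNearlyKahler.cov_apply_self (hNK : IsNearlyKahler J D) {x : M}
    {Y : Π y : M, TangentSpace I y} (hY : MDiffAt (T% Y) x) :
    D (fun y => J y (Y y)) x (Y x) = J x (D Y x (Y x)) :=
  sub_eq_zero.1 (hNK x Y hY)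

/-- Polarization of `(∇_X J) X = 0`. -/
theorem IsNearlyKahler.antisymm (hJ : IsAlmostHermitian J) (hNK : IsNearlyKahler J D) {x : M}
    {X Y : Π y : M, TangentSpace I y} (hX : MDiffAt (T% X) x) (hY : MDiffAt (T% Y) x) :
    D (fun y => J y (Y y)) x (X x) - J x (D Y x (X x))
      = -(D (fun y => J y (X y)) x (Y x) - J x (D X x (Y x))) := by
  have h := hNK x (X + Y) (mdifferentiableAt_add_section hX hY)
  have h' : (fun y => J y ((X + Y) y)) = (fun y => J y (X y)) + fun y => J y (Y y) := by
    ext y; simp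
  rw [h', cov_add D (hJ.mdiffAt_apply hX) (hJ.mdiffAt_apply hY), cov_add D hX hY] at h
  have h1 := hNK x X hX
  have h2 := hNK x Y hY
  simp only [Pi.add_apply, map_add, add_apply] at h
  rw [← sub_eq_zero]
  rw [← h, ← sub_eq_zero]
  linear_combination (norm := module) -h1 - h2

theorem isCanonicalHermitian_canonicalConnection (hJ : IsAlmostHermitian J)
    (hLC : IsLeviCivita D) (hNK : IsNearlyKahler J D) :
    IsCanonicalHermitian J (canonicalConnection hJ D) where
  smooth := by
    refine ⟨⟨fun {Y} hY => ?_⟩⟩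
    rw [contMDiffOn_univ] at hY ⊢
    have hcov {Z : Π y : M, TangentSpace I y} (hZ : CMDiff ∞ (T% Z)) :
        ContMDiff I (I.prod 𝓘(ℝ, E →L[ℝ] E)) ∞ (fun x => TotalSpace.mk' (E →L[ℝ] E)
          (E := fun x : M => TangentSpace I x →L[ℝ] TangentSpace I x) x (D Z x)) :=
      contMDiffOn_univ.1 (hLC.smooth.contMDiff.contMDiff (σ := Z) (contMDiffOn_univ.2 hZ))
    have hJY : CMDiff ∞ (T% (fun y => J y (Y y))) := hJ.smooth.clm_bundle_apply hY
    exact ((hcov hY).sub_section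
      (contMDiff_comp_endomorphism hJ.smooth (hcov hJY))).const_smul_section (a := (1 / 2 : ℝ))
  metric := by
    intro x Y Z v hY hZ
    have h1 := hLC.metric x Y Z v hY hZ
    have h2 := hLC.metric x _ _ v (hJ.mdiffAt_apply hY) (hJ.mdiffAt_apply hZ)
    simp only [hJ.orthogonal] at h2
    simp only [canonicalConnection_apply, inner_smul_right, real_inner_smul_left, inner_sub_left,
      inner_sub_right]
    have h3 := hJ.inner_left (D (fun y => J y (Y y)) x v) (Z x)
    have h4 := hJ.inner_left (Y x) (D (fun y => J y (Z y)) x v)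
    linarith
  parallel := by
    intro x Y v hY
    simp only [canonicalConnection_apply, cov_neg hY, map_smul, map_sub, hJ.sq]
    simp only [neg_apply, map_neg]
    module
  torsion_type := by
    intro x u v
    have hu : MDiffAt (T% (FiberBundle.extend E u : Π y : M, TangentSpace I y)) x :=
      FiberBundle.mdifferentiableAt_extend ..
    have hv : MDiffAt (T% (FiberBundle.extend E v : Π y : M, TangentSpace I y)) x :=
      FiberBundle.mdifferentiableAt_extend ..
    -- For vector fields `X`, `Y`, the torsion is `-J (∇_X J) Y`.
    have htor {X Y : Π y : M, TangentSpace I y} (hX : MDiffAt (T% X) x) (hY : MDiffAt (T% Y) x) :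
        (canonicalConnection hJ D).torsion x (X x) (Y x)
          = -J x (D (fun y => J y (Y y)) x (X x) - J x (D Y x (X x))) := by
      have h1 := D.torsion_apply hX hY
      rw [hLC.torsion_eq_zero] at h1
      have h2 := congr(J x $(hNK.antisymm hJ hX hY))
      rw [(canonicalConnection hJ D).torsion_apply hX hY, canonicalConnection_apply,
        canonicalConnection_apply]
      simp only [map_sub, map_neg, hJ.sq] at h2 ⊢
      have h3 : VectorField.mlieBracket I X Y x = D Y x (X x) - D X x (Y x) := by
        have : (0 : TangentSpace I x) = D Y x (X x) - D X x (Y x)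
          - VectorField.mlieBracket I X Y x := h1
        exact (sub_eq_zero.1 this.symm).symm
      rw [h3]
      linear_combination (norm := module) (1 / 2 : ℝ) • h2
    have e1 := htor (hJ.mdiffAt_apply hu) hv
    have e2 := htor hu (hJ.mdiffAt_apply hv)
    have a1 := hNK.antisymm hJ (hJ.mdiffAt_apply hu) hv
    have a2 := hNK.antisymm hJ hu hv
    simp only [FiberBundle.extend_apply_self] at e1 e2 a1 a2
    have h : (fun y => J y (J y (FiberBundle.extend E u y)))
      = fun y : M => -(FiberBundle.extend E u y : TangentSpace I y) := by ext y; exact hJ.sq y _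
    have h' : (fun y => J y (J y (FiberBundle.extend E v y)))
      = fun y : M => -(FiberBundle.extend E v y : TangentSpace I y) := by ext y; exact hJ.sq y _
    rw [h, cov_neg hu] at a1
    rw [h', cov_neg hv] at e2
    rw [e1, e2, a1]
    simp only [neg_apply, map_neg, map_sub, hJ.sq] at a2 ⊢
    linear_combination (norm := module) a2

/-- The canonical Hermitian connection of a nearly Kähler manifold is unique: the difference of two
such connections is a skew-Hermitian 1-form to which `eq_zero_of_skewHermitian_of_torsion`
applies. -/
theorem IsCanonicalHermitian.eq_canonicalConnection (hJ : IsAlmostHermitian J)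
    (hLC : IsLeviCivita D) (hNK : IsNearlyKahler J D) (hD : IsCanonicalHermitian J D₁) {x : M}
    {Y : Π y : M, TangentSpace I y} (hY : MDiffAt (T% Y) x) (v : TangentSpace I x) :
    D₁ Y x v = (1 / 2 : ℝ) • (D Y x v - J x (D (fun y => J y (Y y)) x v)) := by
  have hC := isCanonicalHermitian_canonicalConnection hJ hLC hNK
  set D₂ := canonicalConnection hJ D with hD₂
  rw [← canonicalConnection_apply hJ, ← hD₂]
  let B (w v : TangentSpace I x) : TangentSpace I x :=
    IsCovariantDerivativeOn.difference D₁.isCovariantDerivativeOnUniv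
      D₂.isCovariantDerivativeOnUniv x w v
  have hB {Z : Π y : M, TangentSpace I y} (hZ : MDiffAt (T% Z) x) (v : TangentSpace I x) :
      B (Z x) v = D₁ Z x v - D₂ Z x v := by
    have := IsCovariantDerivativeOn.difference_apply D₁.isCovariantDerivativeOnUniv
      D₂.isCovariantDerivativeOnUniv (x := x) trivial hZ
    exact congr($this v)
  have hext (w : TangentSpace I x) :
      MDiffAt (T% (FiberBundle.extend E w : Π y : M, TangentSpace I y)) x :=
    FiberBundle.mdifferentiableAt_extend ..
  have hB' (w v : TangentSpace I x) :
      B w v = D₁ (FiberBundle.extend E w) x v - D₂ (FiberBundle.extend E w) x v := by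
    rw [← hB (hext w), FiberBundle.extend_apply_self]
  have h0 := eq_zero_of_skewHermitian_of_torsion (V := TangentSpace I x) (J := J x) (B := B)
    (hJ.sq x) (fun _ _ => map_add _ _ _) (fun _ => map_neg _ _) hJ.inner_left
    (fun v w => map_neg _ _) ?_ ?_ ?_ (Y x) v
  · rw [hB hY] at h0
    exact sub_eq_zero.1 h0
  · intro w v z
    have h1 := hD.metric x _ _ v (hext w) (hext z)
    have h2 := hC.metric x _ _ v (hext w) (hext z)
    rw [hB', hB', inner_sub_left, inner_sub_right]
    simp only [FiberBundle.extend_apply_self] at h1 h2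
    linarith
  · intro w v
    have h3 := hB (hJ.mdiffAt_apply (hext w)) v
    rw [hD.parallel _ _ _ (hext w), hC.parallel _ _ _ (hext w), ← map_sub, ← hB',
      FiberBundle.extend_apply_self] at h3
    exact h3
  · have hT (u v : TangentSpace I x) :
        B v u - B u v = D₁.torsion x u v - D₂.torsion x u v := by
      rw [D₁.torsion_apply_eq_extend, D₂.torsion_apply_eq_extend, hB', hB']
      simp only [FiberBundle.extend_apply_self]
      abel
    intro u v
    rw [hT, hT, hD.torsion_type, hC.torsion_type]

/-- The canonical connection and the Levi-Civita connection differ by a multiple of `J (∇_X J) Y`,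
which is antisymmetric in `X` and `Y`. -/
theorem IsCanonicalHermitian.apply_self (hJ : IsAlmostHermitian J)
    (hLC : IsLeviCivita D) (hNK : IsNearlyKahler J D) (hD : IsCanonicalHermitian J D₁) {x : M}
    {Y : Π y : M, TangentSpace I y} (hY : MDiffAt (T% Y) x) :
    D₁ Y x (Y x) = D Y x (Y x) := by
  rw [hD.eq_canonicalConnection hJ hLC hNK hY, hNK.cov_apply_self hY, hJ.sq]
  module

/-- The difference of the two connections does not contribute to `⟨J Y, ∇_v Y⟩`, because
differentiating `⟨Y, J Y⟩ = 0` gives `⟨(∇_v J) Y, Y⟩ = 0`. -/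
theorem IsCanonicalHermitian.inner_apply (hJ : IsAlmostHermitian J)
    (hLC : IsLeviCivita D) (hNK : IsNearlyKahler J D) (hD : IsCanonicalHermitian J D₁) {x : M}
    {Y : Π y : M, TangentSpace I y} (hY : MDiffAt (T% Y) x) (v : TangentSpace I x) :
    (inner ℝ (J x (Y x)) (D₁ Y x v) : ℝ) = inner ℝ (J x (Y x)) (D Y x v) := by
  have h := hLC.metric x Y _ v hY (hJ.mdiffAt_apply hY)
  simp only [hJ.inner_self] at h
  rw [mvfderiv_const] at h
  rw [hD.eq_canonicalConnection hJ hLC hNK hY, inner_smul_right, inner_sub_right, hJ.orthogonal]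
  have h2 := real_inner_comm (D Y x v) (J x (Y x))
  simp only [zero_apply] at h
  linarith

/-- The difference of the two connections does not contribute to `⟨J w, ∇_w Y⟩` either: exchange
the arguments by antisymmetry and use `IsCanonicalHermitian.inner_apply`. -/
theorem IsCanonicalHermitian.inner_apply_left (hJ : IsAlmostHermitian J)
    (hLC : IsLeviCivita D) (hNK : IsNearlyKahler J D) (hD : IsCanonicalHermitian J D₁) {x : M}
    {Y : Π y : M, TangentSpace I y} (hY : MDiffAt (T% Y) x) (w : TangentSpace I x) :
    (inner ℝ (J x w) (D₁ Y x w) : ℝ) = inner ℝ (J x w) (D Y x w) := by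
  have hw : MDiffAt (T% (FiberBundle.extend E w : Π y : M, TangentSpace I y)) x :=
    FiberBundle.mdifferentiableAt_extend ..
  have h1 := hD.apply_self hJ hLC hNK (mdifferentiableAt_add_section hw hY)
  have h2 := hD.apply_self hJ hLC hNK hw
  have h3 := hD.apply_self hJ hLC hNK hY
  have h4 := hD.inner_apply hJ hLC hNK hw (Y x)
  rw [cov_add _ hw hY, cov_add _ hw hY] at h1
  simp only [Pi.add_apply, map_add, add_apply, FiberBundle.extend_apply_self] at h1 h2 h4
  have h5 : D₁ Y x w - D Y x w
      = -(D₁ (FiberBundle.extend E w) x (Y x) - D (FiberBundle.extend E w) x (Y x)) := by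
    linear_combination (norm := module) h1 - h2 - h3
  rw [← sub_eq_zero, ← inner_sub_right, h5, inner_neg_right, inner_sub_right, h4]
  simp

end Canonical

/-! ### Coordinate fields and second derivatives -/

section Coordinates

variable {E : Type*} [NormedAddCommGroup E] [NormedSpace ℝ E] [FiniteDimensional ℝ E]
  {H : Type*} [TopologicalSpace H] {I : ModelWithCorners ℝ E H}
  {M : Type*} [TopologicalSpace M] [ChartedSpace H M] [IsManifold I ∞ M]
  {F G : Type*} [NormedAddCommGroup F] [NormedSpace ℝ F] [NormedAddCommGroup G] [NormedSpace ℝ G]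

theorem mvfderiv_clm_apply {c : M → F →L[ℝ] G} {u : M → F} {p : M} (hc : MDiffAt c p)
    (hu : MDiffAt u p) (v : TangentSpace I p) :
    mvfderiv I (fun q => c q (u q)) p v
      = mvfderiv I c p v (u p) + c p (mvfderiv I u p v) := by
  let c' : E →L[ℝ] F →L[ℝ] G := mvfderiv I c p
  let u' : E →L[ℝ] F := mvfderiv I u p
  have h : HasMFDerivAt I 𝓘(ℝ, G) (fun q => c q (u q)) p
      ((c p).comp u' + c'.flip (u p) : E →L[ℝ] G) := by
    refine ⟨hc.continuousAt.clm_apply hu.continuousAt, ?_⟩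
    convert! hc.hasMFDerivAt.2.clm_apply hu.hasMFDerivAt.2 using 1
    simp [writtenInExtChartAt]
    rfl
  have h2 := h.mfderiv
  rw [add_comm]
  exact congr($h2 v)

/-- Coordinate vector fields differentiate functions by the partial derivatives in the chart. -/
theorem mvfderiv_localField [I.Boundaryless] {g : M → F} {p q : M} (hq : q ∈ (chartAt H p).source)
    (hg : MDiffAt g q) (a : E) :
    mvfderiv I g q (localField (trivializationAt E (TangentSpace I) p) a q)
      = fderiv ℝ (g ∘ (extChartAt I p).symm) (extChartAt I p q) a := by
  have hq' : q ∈ (extChartAt I p).source := by rwa [extChartAt_source]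
  have hψ : MDifferentiableAt 𝓘(ℝ, E) I (extChartAt I p).symm (extChartAt I p q) := by
    have := mdifferentiableWithinAt_extChartAt_symm (I := I) ((extChartAt I p).map_source hq')
    rwa [I.range_eq_univ, mdifferentiableWithinAt_univ] at this
  have h1 := mfderiv_comp_apply_of_eq (extChartAt I p q) (f := (extChartAt I p).symm) hg hψ
    ((extChartAt I p).left_inv hq') a
  rw [mfderiv_eq_fderiv] at h1
  unfold localField
  rw [TangentBundle.symmL_trivializationAt hq, I.range_eq_univ, mfderivWithin_univ]
  exact h1.symm

variable (I) in
theorem contDiffAt_comp_extChartAt_symm [I.Boundaryless] {g : M → F} {p : M}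
    (hg : CMDiffAt ∞ g p) :
    ContDiffAt ℝ ∞ (g ∘ (extChartAt I p).symm) (extChartAt I p p) := by
  have h := (contMDiffAt_iff.1 hg).2
  rw [I.range_eq_univ, contDiffWithinAt_univ] at h
  exact h

variable (I) in
theorem eventually_mdiffAt {g : M → F} {p : M} (hg : CMDiffAt ∞ g p) :
    ∀ᶠ q in nhds p, q ∈ (chartAt H p).source ∧ MDiffAt g q := by
  have h1 : CMDiffAt 1 g p := hg.of_le (by simp)
  filter_upwards [(chartAt H p).open_source.mem_nhds (mem_chart_source H p),
    (contMDiffAt_iff_contMDiffAt_nhds (by simp)).1 h1] with q hq hq'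
  exact ⟨hq, hq'.mdifferentiableAt (by simp)⟩

variable (I) in
theorem eventually_partial_eq [I.Boundaryless] {g : M → F} {p : M} (hg : CMDiffAt ∞ g p) (a : E) :
    (fun q => mvfderiv I g q (localField (trivializationAt E (TangentSpace I) p) a q)) =ᶠ[nhds p]
      fun q => fderiv ℝ (g ∘ (extChartAt I p).symm) (extChartAt I p q) a := by
  filter_upwards [eventually_mdiffAt I hg] with q hq
  exact mvfderiv_localField hq.1 hq.2 a

/-- The partial derivatives of a smooth function are smooth. -/
theorem contMDiffAt_partial [I.Boundaryless] {g : M → F} {p : M} (hg : CMDiffAt ∞ g p) (a : E) :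
    CMDiffAt ∞
      (fun q => mvfderiv I g q (localField (trivializationAt E (TangentSpace I) p) a q)) p := by
  refine ContMDiffAt.congr_of_eventuallyEq ?_ (eventually_partial_eq I hg a)
  have h := contDiffAt_comp_extChartAt_symm I hg
  have h1 : ContDiffAt ℝ ∞ (fun z => fderiv ℝ (g ∘ (extChartAt I p).symm) z a)
      (extChartAt I p p) := (h.fderiv_right (m := ∞) (by simp)).clm_apply contDiffAt_const
  exact h1.contMDiffAt.comp p contMDiffAt_extChartAt

theorem fderiv_partial [I.Boundaryless] {g : M → F} {p : M} (hg : CMDiffAt ∞ g p) (a b : E) :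
    mvfderiv I (fun q => mvfderiv I g q (localField (trivializationAt E (TangentSpace I) p) a q)) p
      (localField (trivializationAt E (TangentSpace I) p) b p)
      = fderiv ℝ (fderiv ℝ (g ∘ (extChartAt I p).symm)) (extChartAt I p p) b a := by
  rw [mvfderiv_localField (mem_chart_source H p)
    ((contMDiffAt_partial hg a).mdifferentiableAt (by simp))]
  have h := contDiffAt_comp_extChartAt_symm I hg
  have h2 := (h.fderiv_right (m := ∞) (by simp)).differentiableAt (by simp)
  have h3 : (fun q => mvfderiv I g q (localField (trivializationAt E (TangentSpace I) p) a q)) ∘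
      (extChartAt I p).symm =ᶠ[nhds (extChartAt I p p)]
      fun z => fderiv ℝ (g ∘ (extChartAt I p).symm) z a := by
    have hc : ContinuousAt (extChartAt I p).symm (extChartAt I p p) :=
      continuousAt_extChartAt_symm p
    have h4 := hc.eventually (p := fun q =>
      mvfderiv I g q (localField (trivializationAt E (TangentSpace I) p) a q)
        = fderiv ℝ (g ∘ (extChartAt I p).symm) (extChartAt I p q) a)
      (by rw [extChartAt_to_inv]; exact eventually_partial_eq I hg a)
    filter_upwards [h4, extChartAt_target_mem_nhds (I := I) p] with z hz hz'
    simp only [Function.comp_apply, hz, (extChartAt I p).right_inv hz']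
  rw [h3.fderiv_eq, fderiv_clm_apply h2 (by fun_prop)]
  simp

/-- Coordinate vector fields commute. -/
theorem partial_comm [I.Boundaryless] {g : M → F} {p : M} (hg : CMDiffAt ∞ g p) (a b : E) :
    mvfderiv I (fun q => mvfderiv I g q (localField (trivializationAt E (TangentSpace I) p) a q)) p
      (localField (trivializationAt E (TangentSpace I) p) b p)
    = mvfderiv I (fun q => mvfderiv I g q (localField (trivializationAt E (TangentSpace I) p) b q))
      p (localField (trivializationAt E (TangentSpace I) p) a p) := by
  rw [fderiv_partial hg, fderiv_partial hg]
  have h := contDiffAt_comp_extChartAt_symm I hg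
  exact (h.isSymmSndFDerivAt
    (by simpa [minSmoothness] using WithTop.coe_le_coe.2 (le_top (a := (2 : ℕ∞))))) _ _

theorem mlieBracket_localField (x : M) (a b : E) :
    VectorField.mlieBracket I (localField (trivializationAt E (TangentSpace I) x) a)
      (localField (trivializationAt E (TangentSpace I) x) b) x = 0 := by
  have key (a : E) : VectorField.mpullbackWithin 𝓘(ℝ, E) I (extChartAt I x).symm
      (localField (trivializationAt E (TangentSpace I) x) a) (Set.range I)
      =ᶠ[nhdsWithin (extChartAt I x x) (Set.range I)] fun _ => a := by
    filter_upwards [extChartAt_target_mem_nhdsWithin (I := I) x] with z hz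
    have hz' : (extChartAt I x).symm z ∈ (chartAt H x).source := by
      rw [← extChartAt_source I]; exact (extChartAt I x).map_target hz
    simp only [VectorField.mpullbackWithin_apply, localField]
    rw [TangentBundle.symmL_trivializationAt hz', (extChartAt I x).right_inv hz]
    exact (isInvertible_mfderivWithin_extChartAt_symm hz).inverse_apply_eq.2 rfl
  rw [← VectorField.mlieBracketWithin_univ, VectorField.mlieBracketWithin_apply]
  rw [Set.preimage_univ, Set.univ_inter,
    (key a).lieBracketWithin_vectorField_eq_of_mem (key b) ⟨_, rfl⟩]
  have h0 : VectorField.lieBracketWithin ℝ (fun _ : E => a) (fun _ => b) (Set.range I)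
      (extChartAt I x x) = 0 := by simp [VectorField.lieBracketWithin]
  exact (congrArg _ h0).trans
    (ContinuousLinearMap.map_zero (mfderiv I 𝓘(ℝ, E) (extChartAt I x) x).inverse)

end Coordinates

/-! ### Christoffel symbols and the Hessian of a map -/

section Christoffel

variable {E : Type*} [NormedAddCommGroup E] [NormedSpace ℝ E] [FiniteDimensional ℝ E]
  {H : Type*} [TopologicalSpace H] {I : ModelWithCorners ℝ E H}
  {M : Type*} [TopologicalSpace M] [ChartedSpace H M] [IsManifold I ∞ M]
  {D : CovariantDerivative I E (fun x : M => TangentSpace I x)}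

/-- A locally smooth vector field agrees near a given point with a globally smooth one. -/
theorem exists_contMDiff_eventuallyEq [T2Space M] {u : Set M} (hu : IsOpen u) {x : M} (hx : x ∈ u)
    {Y : Π y : M, TangentSpace I y} (hY : CMDiff[u] ∞ (T% Y)) :
    ∃ Z : Π y : M, TangentSpace I y, CMDiff ∞ (T% Z) ∧ ∀ᶠ y in nhds x, Z y = Y y := by
  obtain ⟨χ, -, hχ⟩ := (SmoothBumpFunction.nhds_basis_tsupport (I := I) x).mem_iff.1
    (hu.mem_nhds hx)
  refine ⟨(χ : M → ℝ) • Y, ContMDiffOn.smul_section_of_tsupport χ.contMDiff.contMDiffOn hu hχ hY,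
    ?_⟩
  filter_upwards [χ.eventuallyEq_one] with y hy
  simp [hy]

/-- Smoothness of a connection is a statement about globally smooth fields, so that `localField t w`
is first replaced by a global field with the same germ. -/
theorem contMDiffAt_cov_localField [T2Space M] (hD : D.ContMDiffCovariantDerivative ∞)
    {t : Trivialization E (TotalSpace.proj : TangentBundle I M → M)} [MemTrivializationAtlas t]
    {x : M} (hx : x ∈ t.baseSet) (v w : E) :
    CMDiffAt ∞ (T% (fun y => D (localField t w) y (localField t v y))) x := by
  obtain ⟨Z, hZ, hZY⟩ := exists_contMDiff_eventuallyEq t.open_baseSet hx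
    (fun y hy => (contMDiffAt_localField hy w).contMDiffWithinAt)
  have h1 : ContMDiff I (I.prod 𝓘(ℝ, E →L[ℝ] E)) ∞ (fun x => TotalSpace.mk' (E →L[ℝ] E)
      (E := fun x : M => TangentSpace I x →L[ℝ] TangentSpace I x) x (D Z x)) :=
    contMDiffOn_univ.1 (hD.contMDiff.contMDiff (σ := Z) (contMDiffOn_univ.2 hZ))
  have h2 : CMDiffAt ∞ (T% (fun y => D Z y (localField t v y))) x :=
    (h1 x).clm_bundle_apply (contMDiffAt_localField hx v)
  refine h2.congr_of_eventuallyEq ?_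
  filter_upwards [hZY.eventually_nhds, t.open_baseSet.mem_nhds hx] with y hy hyt
  rw [cov_congr D ((hZ y).mdifferentiableAt (by simp)) (mdifferentiableAt_localField hyt w) hy]

/-- The Christoffel symbols of a connection in the trivialization `t`: the bilinear map which
sends `(v, w)` to the reading in `t` of `D_v w`, where `v` and `w` are constant in `t`. -/
noncomputable def christoffel (t : Trivialization E (TotalSpace.proj : TangentBundle I M → M))
    [MemTrivializationAtlas t] (D : CovariantDerivative I E (fun x : M => TangentSpace I x))
    (y : M) : E →L[ℝ] E →L[ℝ] E :=
  ∑ k, ∑ l, ContinuousLinearMap.smulRightL ℝ E (E →L[ℝ] E)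
    ((Module.finBasis ℝ E).coord k).toContinuousLinearMap
    (ContinuousLinearMap.smulRightL ℝ E E ((Module.finBasis ℝ E).coord l).toContinuousLinearMap
      (t ⟨y, D (localField t (Module.finBasis ℝ E l)) y
        (localField t (Module.finBasis ℝ E k) y)⟩).2)

variable {t : Trivialization E (TotalSpace.proj : TangentBundle I M → M)}
  [MemTrivializationAtlas t]

theorem christoffel_apply {y : M} (hy : y ∈ t.baseSet) (v w : E) :
    christoffel t D y v w = (t ⟨y, D (localField t w) y (localField t v y)⟩).2 := by
  let B : E →ₗ[ℝ] E →ₗ[ℝ] E := LinearMap.mk₂ ℝ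
    (fun v w => (t ⟨y, D (localField t w) y (localField t v y)⟩).2)
    (by intro v v' w
        simp only [localField_add, Pi.add_apply, map_add]
        exact (trivialization_linear t hy).map_add _ _)
    (by intro c v w
        simp only [localField_smul, Pi.smul_apply, map_smul]
        exact (trivialization_linear t hy).map_smul _ _)
    (by intro v w w'
        simp only [localField_add]
        rw [cov_add D (mdifferentiableAt_localField hy _) (mdifferentiableAt_localField hy _)]
        exact (trivialization_linear t hy).map_add _ _)
    (by intro c v w
        simp only [localField_smul]
        rw [cov_smul D _ (mdifferentiableAt_localField hy _)]
        exact (trivialization_linear t hy).map_smul _ _)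
  have h : B v w = christoffel t D y v w := by
    conv_lhs => rw [← (Module.finBasis ℝ E).sum_repr v, ← (Module.finBasis ℝ E).sum_repr w]
    simp only [map_sum, map_smul, LinearMap.sum_apply, LinearMap.smul_apply]
    simp only [B, LinearMap.mk₂_apply, Finset.smul_sum]
    rw [Finset.sum_comm]
    simp only [smul_comm ((Module.finBasis ℝ E).repr w _)]
    simp [christoffel]
  rw [← h]
  rfl

set_option synthInstance.maxHeartbeats 200000 in
theorem contMDiffAt_christoffel [T2Space M] (hD : D.ContMDiffCovariantDerivative ∞) {x : M}
    (hx : x ∈ t.baseSet) : CMDiffAt ∞ (christoffel t D) x := by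
  unfold christoffel
  refine contMDiffAt_finsetSum fun k _ => contMDiffAt_finsetSum fun l _ => ?_
  have h := (t.contMDiffAt_section_iff hx).1 (contMDiffAt_cov_localField hD hx
    (Module.finBasis ℝ E k) (Module.finBasis ℝ E l))
  have h1 : ContDiff ℝ ∞ (ContinuousLinearMap.smulRightL ℝ E E
      ((Module.finBasis ℝ E).coord l).toContinuousLinearMap) := ContinuousLinearMap.contDiff _
  have h2 : ContDiff ℝ ∞ (ContinuousLinearMap.smulRightL ℝ E (E →L[ℝ] E)
      ((Module.finBasis ℝ E).coord k).toContinuousLinearMap) := ContinuousLinearMap.contDiff _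
  exact (h2.comp h1).contMDiff.contMDiffAt.comp x h

/-- The Christoffel symbols of a torsion-free connection in a chart are symmetric. -/
theorem christoffel_symm (hD : D.torsion = 0) (x : M) (a b : E) :
    christoffel (trivializationAt E (TangentSpace I) x) D x a b
      = christoffel (trivializationAt E (TangentSpace I) x) D x b a := by
  have hx := FiberBundle.mem_baseSet_trivializationAt' (F := E)
    (E := fun x : M => TangentSpace I x) x
  have h := D.torsion_apply (mdifferentiableAt_localField hx a) (mdifferentiableAt_localField hx b)
  rw [hD] at h
  have h0 : (0 : TangentSpace I x)
    = D (localField (trivializationAt E (TangentSpace I) x) b) x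
        (localField (trivializationAt E (TangentSpace I) x) a x)
      - D (localField (trivializationAt E (TangentSpace I) x) a) x
        (localField (trivializationAt E (TangentSpace I) x) b x)
      - VectorField.mlieBracket I (localField (trivializationAt E (TangentSpace I) x) a)
        (localField (trivializationAt E (TangentSpace I) x) b) x := h
  have h1 := mlieBracket_localField (I := I) x a b
  rw [christoffel_apply hx, christoffel_apply hx]
  have h2 : D (localField (trivializationAt E (TangentSpace I) x) b) x
      (localField (trivializationAt E (TangentSpace I) x) a x)
      = D (localField (trivializationAt E (TangentSpace I) x) a) x
      (localField (trivializationAt E (TangentSpace I) x) b x) := by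
    rw [h1, sub_zero] at h0
    exact sub_eq_zero.1 h0.symm
  rw [h2]

/-- The reading in `t` of `D_v Y` for a vector field `Y` with reading `S` is
`d_v S + Γ (v, S)`. -/
theorem apply_cov {x : M} (hx : x ∈ t.baseSet) {Y : Π y : M, TangentSpace I y}
    (hY : MDiffAt (T% Y) x) (v : TangentSpace I x) :
    (t ⟨x, D Y x v⟩).2 = mvfderiv I (fun y => (t ⟨y, Y y⟩).2) x v
      + christoffel t D x (t ⟨x, v⟩).2 (t ⟨x, Y x⟩).2 := by
  rw [cov_eq_local D hx hY, christoffel_apply hx, localField_eq_self hx]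
  refine ((trivialization_linear t hx).map_add _ _).trans ?_
  congr 1
  exact apply_symmL t hx _

section Map

variable {E' : Type*} [NormedAddCommGroup E'] [NormedSpace ℝ E'] [FiniteDimensional ℝ E']
  {H' : Type*} [TopologicalSpace H'] {I' : ModelWithCorners ℝ E' H'}
  {L : Type*} [TopologicalSpace L] [ChartedSpace H' L]
  {f : L → M} {s : Π q : L, TangentSpace I (f q)} {p : L}

theorem apply_covAlong (ht : f p ∈ t.baseSet) (hs : MDiffAlong I' f s p)
    (v : TangentSpace I' p) :
    (t ⟨f p, covAlong I' D f s p v⟩).2 = mvfderiv I' (fun q => (t ⟨f q, s q⟩).2) p v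
      + christoffel t D (f p) (t ⟨f p, mfderiv I' I f p v⟩).2 (t ⟨f p, s p⟩).2 := by
  rw [covAlong_eq_covAlongIn_of_mem ht hs, christoffel_apply ht, localField_eq_self ht]
  refine ((trivialization_linear t ht).map_add _ _).trans ?_
  congr 1
  exact apply_symmL t ht _

/-- In a chart, `df` is the derivative of the coordinate expression of `f`. -/
theorem apply_mfderiv {x : M} {q : L} (hq : f q ∈ (chartAt H x).source)
    (hf : MDifferentiableAt I' I f q) (v : TangentSpace I' q) :
    (trivializationAt E (TangentSpace I) x ⟨f q, mfderiv I' I f q v⟩).2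
      = mvfderiv I' (fun q => extChartAt I x (f q)) q v := by
  have h1 : MDifferentiableAt I 𝓘(ℝ, E) (extChartAt I x) (f q) := mdifferentiableAt_extChartAt hq
  rw [mvfderiv_comp_vector h1 hf]
  have h2 := TangentBundle.continuousLinearMapAt_trivializationAt (I := I) hq
  have h4 := (trivializationAt E (TangentSpace I) x).continuousLinearMapAt_apply_of_mem (R := ℝ)
    (b := f q) hq (mfderiv I' I f q v)
  rw [h2] at h4
  exact h4.symm

variable [IsManifold I' ∞ L]

theorem eventually_apply_mfderiv_localField (hf : ContMDiff I' I ∞ f) (p : L) (a : E') :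
    ∀ᶠ q in nhds p, (trivializationAt E (TangentSpace I) (f p) ⟨f q, mfderiv I' I f q
        (localField (trivializationAt E' (TangentSpace I') p) a q)⟩).2
      = mvfderiv I' (fun q => extChartAt I (f p) (f q)) q
        (localField (trivializationAt E' (TangentSpace I') p) a q) := by
  filter_upwards [hf.continuous.continuousAt.eventually_mem
    ((chartAt H (f p)).open_source.mem_nhds (mem_chart_source H (f p)))] with q hq
  exact apply_mfderiv hq ((hf q).mdifferentiableAt (by simp)) _

theorem contMDiffAt_extChartAt_comp (hf : ContMDiff I' I ∞ f) (p : L) :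
    CMDiffAt ∞ (fun q => extChartAt I (f p) (f q)) p :=
  contMDiffAt_extChartAt.comp p (hf p)

variable [I'.Boundaryless]

theorem mdiffAlong_mfderiv_localField (hf : ContMDiff I' I ∞ f) (p : L) (a : E') :
    MDiffAlong I' f (fun q => mfderiv I' I f q
      (localField (trivializationAt E' (TangentSpace I') p) a q)) p := by
  rw [mdiffAlong_iff (trivializationAt E (TangentSpace I) (f p))
    (FiberBundle.mem_baseSet_trivializationAt' (f p))]
  refine ⟨(hf p).mdifferentiableAt (by simp), ?_⟩
  exact ((contMDiffAt_partial (contMDiffAt_extChartAt_comp hf p) a).mdifferentiableAt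
    (by simp)).congr_of_eventuallyEq (eventually_apply_mfderiv_localField hf p a)

theorem eventually_mfderiv_extend (v : TangentSpace I' p) :
    ∀ᶠ q in nhds p, mfderiv I' I f q (FiberBundle.extend E' v q)
      = mfderiv I' I f q (localField (trivializationAt E' (TangentSpace I') p)
        (trivializationAt E' (TangentSpace I') p ⟨p, v⟩).2 q) := by
  filter_upwards [extend_eventuallyEq_localField v] with q hq
  rw [hq]

theorem mdiffAlong_mfderiv_extend (hf : ContMDiff I' I ∞ f) (v : TangentSpace I' p) :
    MDiffAlong I' f (fun q => mfderiv I' I f q (FiberBundle.extend E' v q)) p :=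
  (mdiffAlong_mfderiv_localField hf p _).congr (eventually_mfderiv_extend v)

/-- For a torsion-free connection, the second fundamental form is symmetric; more precisely, so is
the Hessian `∇ df`. -/
theorem covAlong_mfderiv_symm (hD : D.torsion = 0) (hf : ContMDiff I' I ∞ f)
    (u v : TangentSpace I' p) :
    covAlong I' D f (fun q => mfderiv I' I f q (FiberBundle.extend E' v q)) p u
      = covAlong I' D f (fun q => mfderiv I' I f q (FiberBundle.extend E' u q)) p v := by
  have hp : f p ∈ (trivializationAt E (TangentSpace I) (f p)).baseSet :=
    FiberBundle.mem_baseSet_trivializationAt' (f p)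
  have hp' : p ∈ (trivializationAt E' (TangentSpace I') p).baseSet :=
    FiberBundle.mem_baseSet_trivializationAt' p
  have key (a b : E') : (trivializationAt E (TangentSpace I) (f p) ⟨f p, covAlong I' D f
      (fun q => mfderiv I' I f q (localField (trivializationAt E' (TangentSpace I') p) a q)) p
      (localField (trivializationAt E' (TangentSpace I') p) b p)⟩).2 =
      mvfderiv I' (fun q => mvfderiv I' (fun q => extChartAt I (f p) (f q)) q
        (localField (trivializationAt E' (TangentSpace I') p) a q)) p
        (localField (trivializationAt E' (TangentSpace I') p) b p)
      + christoffel (trivializationAt E (TangentSpace I) (f p)) D (f p)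
        (mvfderiv I' (fun q => extChartAt I (f p) (f q)) p
          (localField (trivializationAt E' (TangentSpace I') p) b p))
        (mvfderiv I' (fun q => extChartAt I (f p) (f q)) p
          (localField (trivializationAt E' (TangentSpace I') p) a p)) := by
    rw [apply_covAlong hp (mdiffAlong_mfderiv_localField hf p a),
      mvfderiv_congr (eventually_apply_mfderiv_localField hf p a),
      (eventually_apply_mfderiv_localField hf p a).self_of_nhds,
      (eventually_apply_mfderiv_localField hf p b).self_of_nhds]
  rw [covAlong_congr (eventually_mfderiv_extend v), covAlong_congr (eventually_mfderiv_extend u)]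
  have k1 := key (trivializationAt E' (TangentSpace I') p ⟨p, v⟩).2
    (trivializationAt E' (TangentSpace I') p ⟨p, u⟩).2
  have k2 := key (trivializationAt E' (TangentSpace I') p ⟨p, u⟩).2
    (trivializationAt E' (TangentSpace I') p ⟨p, v⟩).2
  rw [partial_comm (contMDiffAt_extChartAt_comp hf p), christoffel_symm hD, ← k2] at k1
  simp only [localField_eq_self hp'] at k1
  rw [← symmL_apply_apply _ hp (covAlong I' D f _ p u), k1, symmL_apply_apply _ hp]

end Map

end Christoffel

/-! ### Curvature along a map -/

section SmoothAlong

variable {E : Type*} [NormedAddCommGroup E] [NormedSpace ℝ E] [FiniteDimensional ℝ E]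
  {H : Type*} [TopologicalSpace H] {I : ModelWithCorners ℝ E H}
  {M : Type*} [TopologicalSpace M] [ChartedSpace H M] [IsManifold I ∞ M]
  {E' : Type*} [NormedAddCommGroup E'] [NormedSpace ℝ E']
  {H' : Type*} [TopologicalSpace H'] {I' : ModelWithCorners ℝ E' H'}
  {L : Type*} [TopologicalSpace L] [ChartedSpace H' L]

variable (I') in
/-- The vector field `s` along `f` is smooth at `p`. -/
abbrev SmoothAlong (f : L → M) (s : Π q : L, TangentSpace I (f q)) (p : L) : Prop :=
  ContMDiffAt I' I.tangent ∞ (fun q => (⟨f q, s q⟩ : TangentBundle I M)) p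

variable {f : L → M} {s s' : Π q : L, TangentSpace I (f q)} {p : L}

theorem smoothAlong_iff (t : Trivialization E (TotalSpace.proj : TangentBundle I M → M))
    [MemTrivializationAtlas t] (ht : f p ∈ t.baseSet) :
    SmoothAlong I' f s p ↔
      ContMDiffAt I' I ∞ f p ∧ CMDiffAt ∞ (fun q => (t ⟨f q, s q⟩).2) p :=
  t.contMDiffAt_iff (IB := I) (IM := I')
    (f := fun q => (⟨f q, s q⟩ : TangentBundle I M)) (t.mem_source.2 ht)

theorem SmoothAlong.mdiffAlong (hs : SmoothAlong I' f s p) : MDiffAlong I' f s p :=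
  hs.mdifferentiableAt (by simp)

theorem SmoothAlong.base (hs : SmoothAlong I' f s p) : ContMDiffAt I' I ∞ f p :=
  ((smoothAlong_iff (trivializationAt E (TangentSpace I) (f p))
    (FiberBundle.mem_baseSet_trivializationAt' (f p))).1 hs).1

theorem SmoothAlong.eventually_mdiffAlong [IsManifold I' ∞ L] (hs : SmoothAlong I' f s p) :
    ∀ᶠ q in nhds p, MDiffAlong I' f s q := by
  have h1 : ContMDiffAt I' I.tangent 1 (fun q => (⟨f q, s q⟩ : TangentBundle I M)) p :=
    hs.of_le (by simp)
  have : IsManifold I' 1 L := IsManifold.of_le (n := ∞) (by simp)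
  filter_upwards [(contMDiffAt_iff_contMDiffAt_nhds (by simp)).1 h1] with q hq
  exact hq.mdifferentiableAt (by simp)

end SmoothAlong

section Curvature

variable {E : Type*} [NormedAddCommGroup E] [NormedSpace ℝ E] [FiniteDimensional ℝ E]
  {H : Type*} [TopologicalSpace H] {I : ModelWithCorners ℝ E H} [I.Boundaryless]
  {M : Type*} [TopologicalSpace M] [T2Space M] [ChartedSpace H M] [IsManifold I ∞ M]
  {D : CovariantDerivative I E (fun x : M => TangentSpace I x)}

set_option synthInstance.maxHeartbeats 200000 in
theorem apply_cov_cov_localField (hD : D.ContMDiffCovariantDerivative ∞)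
    {t : Trivialization E (TotalSpace.proj : TangentBundle I M → M)} [MemTrivializationAtlas t]
    {x : M} (hx : x ∈ t.baseSet) (a b c : E) :
    (t ⟨x, D (fun y => D (localField t c) y (localField t b y)) x (localField t a x)⟩).2
      = mvfderiv I (christoffel t D) x (localField t a x) b c
        + christoffel t D x a (christoffel t D x b c) := by
  have hΓ := (contMDiffAt_christoffel hD hx).mdifferentiableAt (by simp)
  rw [apply_cov hx ((contMDiffAt_cov_localField hD hx b c).mdifferentiableAt (by simp)),
    apply_localField hx, christoffel_apply hx b c]
  congr 1
  have h1 : (fun y => (t ⟨y, D (localField t c) y (localField t b y)⟩).2)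
      =ᶠ[nhds x] fun y => christoffel t D y b c := by
    filter_upwards [t.open_baseSet.mem_nhds hx] with y hy
    rw [christoffel_apply hy]
  rw [mvfderiv_congr h1]
  exact congr($(mvfderiv_clm_comp (((ContinuousLinearMap.apply ℝ E c)).comp
    (ContinuousLinearMap.apply ℝ (E →L[ℝ] E) b)) hΓ) (localField t a x))

/-- The curvature tensor in a chart: `R (u, v) w = dΓ (u) (v, w) - dΓ (v) (u, w)
+ Γ (u, Γ (v, w)) - Γ (v, Γ (u, w))`. The bracket term of the definition vanishes, since the
extensions of `u` and `v` agree near `x` with coordinate fields. -/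
theorem apply_curvature (hD : D.ContMDiffCovariantDerivative ∞) (x : M)
    (u v w : TangentSpace I x) :
    letI t := trivializationAt E (TangentSpace I) x
    (t ⟨x, curvature D x u v w⟩).2
      = mvfderiv I (christoffel t D) x u (t ⟨x, v⟩).2 (t ⟨x, w⟩).2
        - mvfderiv I (christoffel t D) x v (t ⟨x, u⟩).2 (t ⟨x, w⟩).2
        + christoffel t D x (t ⟨x, u⟩).2 (christoffel t D x (t ⟨x, v⟩).2 (t ⟨x, w⟩).2)
        - christoffel t D x (t ⟨x, v⟩).2 (christoffel t D x (t ⟨x, u⟩).2 (t ⟨x, w⟩).2) := by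
  have hx := FiberBundle.mem_baseSet_trivializationAt' (F := E)
    (E := fun x : M => TangentSpace I x) x
  set t := trivializationAt E (TangentSpace I) x with ht
  have hext (w : TangentSpace I x) : ∀ᶠ y in nhds x,
      MDiffAt (T% (FiberBundle.extend E w : Π y : M, TangentSpace I y)) y := by
    filter_upwards [(extend_eventuallyEq_localField w).eventually_nhds,
      t.open_baseSet.mem_nhds hx] with y hy hyt
    exact (mdifferentiableAt_localField hyt _).congr_of_eventuallyEq
      (hy.mono fun z hz => by simp only [hz]; rfl)
  have h1 (v w : TangentSpace I x) : ∀ᶠ y in nhds x,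
      D (FiberBundle.extend E w) y ((FiberBundle.extend E v : Π y : M, TangentSpace I y) y)
        = D (localField t (t ⟨x, w⟩).2) y (localField t (t ⟨x, v⟩).2 y) := by
    filter_upwards [(extend_eventuallyEq_localField w).eventually_nhds, hext w,
      extend_eventuallyEq_localField v, t.open_baseSet.mem_nhds hx] with y hy hyw hyv hyt
    rw [cov_congr D hyw (mdifferentiableAt_localField hyt _) hy, hyv]
  have h2 (v w : TangentSpace I x) : D (fun y => D (FiberBundle.extend E w) y
      ((FiberBundle.extend E v : Π y : M, TangentSpace I y) y)) x
        = D (fun y => D (localField t (t ⟨x, w⟩).2) y (localField t (t ⟨x, v⟩).2 y)) x := by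
    have h3 := (contMDiffAt_cov_localField hD hx (t ⟨x, v⟩).2 (t ⟨x, w⟩).2).mdifferentiableAt
      (n := ∞) (by simp)
    refine cov_congr D (h3.congr_of_eventuallyEq ((h1 v w).mono fun z hz => ?_)) h3 (h1 v w)
    simp only [hz]
    rfl
  have h4 : VectorField.mlieBracket I (FiberBundle.extend E u : Π y : M, TangentSpace I y)
      (FiberBundle.extend E v) x = 0 := by
    rw [Filter.EventuallyEq.mlieBracket_vectorField_eq (extend_eventuallyEq_localField u)
      (extend_eventuallyEq_localField v)]
    exact mlieBracket_localField x _ _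
  have h5 : curvature D x u v w
      = D (fun y => D (localField t (t ⟨x, w⟩).2) y (localField t (t ⟨x, v⟩).2 y)) x u
        - D (fun y => D (localField t (t ⟨x, w⟩).2) y (localField t (t ⟨x, u⟩).2 y)) x v := by
    unfold curvature
    rw [h2, h2, h4, map_zero, sub_zero]
  have k (u v : TangentSpace I x) :
      (t ⟨x, D (fun y => D (localField t (t ⟨x, w⟩).2) y (localField t (t ⟨x, v⟩).2 y)) x u⟩).2
      = mvfderiv I (christoffel t D) x u (t ⟨x, v⟩).2 (t ⟨x, w⟩).2
        + christoffel t D x (t ⟨x, u⟩).2 (christoffel t D x (t ⟨x, v⟩).2 (t ⟨x, w⟩).2) := by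
    have := apply_cov_cov_localField hD hx (t ⟨x, u⟩).2 (t ⟨x, v⟩).2 (t ⟨x, w⟩).2
    rwa [localField_eq_self hx u] at this
  rw [h5]
  refine ((trivialization_linear t hx).map_sub _ _).trans ?_
  rw [k u v, k v u]
  abel

variable {E' : Type*} [NormedAddCommGroup E'] [NormedSpace ℝ E'] [FiniteDimensional ℝ E']
  {H' : Type*} [TopologicalSpace H'] {I' : ModelWithCorners ℝ E' H'} [I'.Boundaryless]
  {L : Type*} [TopologicalSpace L] [ChartedSpace H' L] [IsManifold I' ∞ L]
  {f : L → M} {s : Π q : L, TangentSpace I (f q)} {p : L}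

variable (I') in
/-- The covariant derivative of `s` in the direction of the coordinate field around `p` with
constant reading `a`. -/
noncomputable def partialAlong (D : CovariantDerivative I E (fun x : M => TangentSpace I x))
    (f : L → M) (s : Π q : L, TangentSpace I (f q)) (p : L) (a : E') (q : L) :
    TangentSpace I (f q) :=
  covAlong I' D f s q (localField (trivializationAt E' (TangentSpace I') p) a q)

theorem eventually_apply_partialAlong (hf : ContMDiff I' I ∞ f) (hs : SmoothAlong I' f s p)
    (a : E') :
    letI t := trivializationAt E (TangentSpace I) (f p)
    letI t' := trivializationAt E' (TangentSpace I') p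
    ∀ᶠ q in nhds p, (t ⟨f q, partialAlong I' D f s p a q⟩).2 =
      mvfderiv I' (fun q => (t ⟨f q, s q⟩).2) q (localField t' a q)
      + christoffel t D (f q)
        (mvfderiv I' (fun q => extChartAt I (f p) (f q)) q (localField t' a q))
        (t ⟨f q, s q⟩).2 := by
  filter_upwards [hs.eventually_mdiffAlong, eventually_apply_mfderiv_localField hf p a,
    eventually_mem_baseSet (trivializationAt E (TangentSpace I) (f p))
      (FiberBundle.mem_baseSet_trivializationAt' (f p))
    hf.continuous.continuousAt] with q hq hq' ht
  rw [← hq']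
  exact apply_covAlong ht hq _

theorem mdiffAt_christoffel_comp (hD : D.ContMDiffCovariantDerivative ∞)
    (hf : ContMDiff I' I ∞ f) :
    MDiffAt (fun q => christoffel (trivializationAt E (TangentSpace I) (f p)) D (f q)) p :=
  ((contMDiffAt_christoffel hD (FiberBundle.mem_baseSet_trivializationAt' (f p))).mdifferentiableAt
    (n := ∞) (by simp)).comp p ((hf p).mdifferentiableAt (by simp))

theorem mdiffAlong_partialAlong (hD : D.ContMDiffCovariantDerivative ∞)
    (hf : ContMDiff I' I ∞ f) (hs : SmoothAlong I' f s p) (a : E') :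
    MDiffAlong I' f (partialAlong I' D f s p a) p := by
  have hp : f p ∈ (trivializationAt E (TangentSpace I) (f p)).baseSet :=
    FiberBundle.mem_baseSet_trivializationAt' (f p)
  have hS := ((smoothAlong_iff _ hp).1 hs).2
  rw [mdiffAlong_iff _ hp]
  refine ⟨(hf p).mdifferentiableAt (by simp), MDifferentiableAt.congr_of_eventuallyEq ?_
    (eventually_apply_partialAlong hf hs a)⟩
  refine ((contMDiffAt_partial hS a).mdifferentiableAt (by simp)).add ?_
  exact ((mdiffAt_christoffel_comp hD hf).clm_apply ((contMDiffAt_partial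
    (contMDiffAt_extChartAt_comp hf p) a).mdifferentiableAt (by simp))).clm_apply
    (hS.mdifferentiableAt (by simp))

/-- The curvature measures the failure of second covariant derivatives along a map to commute. -/
theorem curvature_eq_partialAlong (hD : D.ContMDiffCovariantDerivative ∞)
    (hf : ContMDiff I' I ∞ f) (hs : SmoothAlong I' f s p) (a b : E') :
    letI t' := trivializationAt E' (TangentSpace I') p
    curvature D (f p) (mfderiv I' I f p (localField t' a p)) (mfderiv I' I f p (localField t' b p))
      (s p)
    = partialAlong I' D f (partialAlong I' D f s p b) p a p
      - partialAlong I' D f (partialAlong I' D f s p a) p b p := by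
  have hp : f p ∈ (trivializationAt E (TangentSpace I) (f p)).baseSet :=
    FiberBundle.mem_baseSet_trivializationAt' (f p)
  have hS := ((smoothAlong_iff _ hp).1 hs).2
  have hS' := hS.mdifferentiableAt (by simp)
  have hF := contMDiffAt_extChartAt_comp hf p
  have hΓ := mdiffAt_christoffel_comp (p := p) hD hf
  set t := trivializationAt E (TangentSpace I) (f p) with ht
  set A := fun a : E' => localField (trivializationAt E' (TangentSpace I') p) a with hA
  set S := fun q => (t ⟨f q, s q⟩).2 with hSdef
  set F := fun q => extChartAt I (f p) (f q) with hFdef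
  -- Second covariant derivatives in the chart; the terms that are not symmetric in `a` and `b` are
  -- those of `apply_curvature`.
  have key (a b : E') :
      (t ⟨f p, partialAlong I' D f (partialAlong I' D f s p b) p a p⟩).2 =
      mvfderiv I' (fun q => mvfderiv I' S q (A b q)) p (A a p)
      + ((mvfderiv I (christoffel t D) (f p) (mfderiv I' I f p (A a p))
            (mvfderiv I' F p (A b p)) (S p)
        + christoffel t D (f p) (mvfderiv I' (fun q => mvfderiv I' F q (A b q)) p (A a p)) (S p))
        + christoffel t D (f p) (mvfderiv I' F p (A b p)) (mvfderiv I' S p (A a p)))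
      + christoffel t D (f p) (mvfderiv I' F p (A a p)) (mvfderiv I' S p (A b p)
        + christoffel t D (f p) (mvfderiv I' F p (A b p)) (S p)) := by
    have hb := eventually_apply_partialAlong (D := D) hf hs b
    have hFb := (contMDiffAt_partial hF b).mdifferentiableAt (n := ∞) (by simp)
    have hSb := (contMDiffAt_partial hS b).mdifferentiableAt (n := ∞) (by simp)
    refine (apply_covAlong (I' := I') (D := D) hp (mdiffAlong_partialAlong hD hf hs b)
      (A a p)).trans ?_
    have e1 := mvfderiv_clm_apply (hΓ.clm_apply hFb) hS' (A a p)
    have e2 := mvfderiv_clm_apply hΓ hFb (A a p)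
    have e3 := mvfderiv_comp_vector ((contMDiffAt_christoffel hD hp).mdifferentiableAt
      (n := ∞) (by simp)) ((hf p).mdifferentiableAt (by simp))
    have e4 := (eventually_apply_mfderiv_localField hf p a).self_of_nhds
    rw [mvfderiv_congr hb, hb.self_of_nhds,
      mvfderiv_fun_add hSb ((hΓ.clm_apply hFb).clm_apply hS'), add_apply]
    rw [e1, e2, e3, e4]
    rfl
  have e (a : E') : (t ⟨f p, mfderiv I' I f p (A a p)⟩).2 = mvfderiv I' F p (A a p) :=
    (eventually_apply_mfderiv_localField hf p a).self_of_nhds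
  have h1 : (t ⟨f p, curvature D (f p) (mfderiv I' I f p (A a p)) (mfderiv I' I f p (A b p))
      (s p)⟩).2 =
      mvfderiv I (christoffel t D) (f p) (mfderiv I' I f p (A a p))
          (t ⟨f p, mfderiv I' I f p (A b p)⟩).2 (S p)
        - mvfderiv I (christoffel t D) (f p) (mfderiv I' I f p (A b p))
          (t ⟨f p, mfderiv I' I f p (A a p)⟩).2 (S p)
        + christoffel t D (f p) (t ⟨f p, mfderiv I' I f p (A a p)⟩).2
          (christoffel t D (f p) (t ⟨f p, mfderiv I' I f p (A b p)⟩).2 (S p))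
        - christoffel t D (f p) (t ⟨f p, mfderiv I' I f p (A b p)⟩).2
          (christoffel t D (f p) (t ⟨f p, mfderiv I' I f p (A a p)⟩).2 (S p)) :=
    apply_curvature hD (f p) (mfderiv I' I f p (A a p)) (mfderiv I' I f p (A b p)) (s p)
  have h2 := (trivialization_linear t hp).map_sub
    (partialAlong I' D f (partialAlong I' D f s p b) p a p)
    (partialAlong I' D f (partialAlong I' D f s p a) p b p)
  rw [key a b, key b a] at h2
  have h3 : mvfderiv I' (fun q => mvfderiv I' S q (A a q)) p (A b p)
      = mvfderiv I' (fun q => mvfderiv I' S q (A b q)) p (A a p) := partial_comm hS a b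
  have h4 : mvfderiv I' (fun q => mvfderiv I' F q (A a q)) p (A b p)
      = mvfderiv I' (fun q => mvfderiv I' F q (A b q)) p (A a p) := partial_comm hF a b
  have h5 : (t ⟨f p, curvature D (f p) (mfderiv I' I f p (A a p)) (mfderiv I' I f p (A b p))
      (s p)⟩).2 = (t ⟨f p, partialAlong I' D f (partialAlong I' D f s p b) p a p
      - partialAlong I' D f (partialAlong I' D f s p a) p b p⟩).2 := by
    refine h1.trans (Eq.trans ?_ h2.symm)
    rw [e, e, h3, h4, map_add, map_add]
    abel
  have h6 := congrArg (t.symmL ℝ (f p)) h5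
  rwa [symmL_apply_apply t hp, symmL_apply_apply t hp] at h6

end Curvature

/-! ### Local lifts of the Gauss map -/

section Frames

variable {E : Type*} [NormedAddCommGroup E] [NormedSpace ℝ E] [FiniteDimensional ℝ E]
  {H : Type*} [TopologicalSpace H] {I : ModelWithCorners ℝ E H}
  {M : Type*} [TopologicalSpace M] [ChartedSpace H M] [IsManifold I ∞ M]
  {E' : Type*} [NormedAddCommGroup E'] [NormedSpace ℝ E']
  {H' : Type*} [TopologicalSpace H'] {I' : ModelWithCorners ℝ E' H'}
  {L : Type*} [TopologicalSpace L] [ChartedSpace H' L]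
  {f : L → M} {s s' : Π q : L, TangentSpace I (f q)} {p : L}

theorem SmoothAlong.add (hs : SmoothAlong I' f s p) (hs' : SmoothAlong I' f s' p) :
    SmoothAlong I' f (fun q => s q + s' q) p := by
  have hf := hs.base
  let t := trivializationAt E (TangentSpace I) (f p)
  have ht : f p ∈ t.baseSet := FiberBundle.mem_baseSet_trivializationAt' (f p)
  rw [smoothAlong_iff t ht] at hs hs' ⊢
  refine ⟨hf, (hs.2.add hs'.2).congr_of_eventuallyEq ?_⟩
  filter_upwards [eventually_mem_baseSet t ht hf.continuousAt] with q hq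
  exact (trivialization_linear t hq).map_add _ _

theorem SmoothAlong.smul {c : L → ℝ} (hc : CMDiffAt ∞ c p) (hs : SmoothAlong I' f s p) :
    SmoothAlong I' f (fun q => c q • s q) p := by
  have hf := hs.base
  let t := trivializationAt E (TangentSpace I) (f p)
  have ht : f p ∈ t.baseSet := FiberBundle.mem_baseSet_trivializationAt' (f p)
  rw [smoothAlong_iff t ht] at hs ⊢
  refine ⟨hf, (hc.smul hs.2).congr_of_eventuallyEq ?_⟩
  filter_upwards [eventually_mem_baseSet t ht hf.continuousAt] with q hq
  exact (trivialization_linear t hq).map_smul _ _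

theorem smoothAlong_zero (hf : ContMDiffAt I' I ∞ f p) :
    SmoothAlong I' f (fun q => (0 : TangentSpace I (f q))) p := by
  let t := trivializationAt E (TangentSpace I) (f p)
  have ht : f p ∈ t.baseSet := FiberBundle.mem_baseSet_trivializationAt' (f p)
  rw [smoothAlong_iff t ht]
  refine ⟨hf, (contMDiffAt_const (c := (0 : E))).congr_of_eventuallyEq ?_⟩
  filter_upwards [eventually_mem_baseSet t ht hf.continuousAt] with q hq
  exact (trivialization_linear t hq).map_zero

theorem SmoothAlong.sub (hs : SmoothAlong I' f s p) (hs' : SmoothAlong I' f s' p) :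
    SmoothAlong I' f (fun q => s q - s' q) p := by
  have h := hs.add (hs'.smul (c := fun _ => -1) contMDiffAt_const)
  simpa only [neg_one_smul, ← sub_eq_add_neg] using h

theorem smoothAlong_sum {ι : Type*} {S : Finset ι} {s : ι → Π q : L, TangentSpace I (f q)}
    (hf : ContMDiffAt I' I ∞ f p) (hs : ∀ i ∈ S, SmoothAlong I' f (s i) p) :
    SmoothAlong I' f (fun q => ∑ i ∈ S, s i q) p := by
  classical
  induction S using Finset.induction_on with
  | empty => simpa using smoothAlong_zero hf
  | insert i S hi ih =>
    simp only [Finset.sum_insert hi]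
    exact (hs i (Finset.mem_insert_self i S)).add
      (ih fun j hj => hs j (Finset.mem_insert_of_mem hj))

theorem smoothAlong_mfderiv_localField [FiniteDimensional ℝ E'] [IsManifold I' ∞ L]
    (hf : ContMDiff I' I ∞ f)
    {t : Trivialization E' (TotalSpace.proj : TangentBundle I' L → L)} [MemTrivializationAtlas t]
    (hp : p ∈ t.baseSet) (a : E') :
    SmoothAlong I' f (fun q => mfderiv I' I f q (localField t a q)) p :=
  ((hf.contMDiff_tangentMap (m := ∞) (by simp)).contMDiffAt).comp p (contMDiffAt_localField hp a)

variable [RiemannianBundle (fun x : M => TangentSpace I x)]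
  [IsContMDiffRiemannianBundle I ∞ E (fun x : M => TangentSpace I x)]

theorem SmoothAlong.inner (hs : SmoothAlong I' f s p) (hs' : SmoothAlong I' f s' p) :
    CMDiffAt ∞ (fun q => (inner ℝ (s q) (s' q) : ℝ)) p :=
  ContMDiffAt.inner_bundle (IB := I) (E := fun x : M => TangentSpace I x) hs hs'

theorem smoothAlong_gramSchmidt {n : ℕ} {w : Fin n → Π q : L, TangentSpace I (f q)}
    (hf : ContMDiffAt I' I ∞ f p)
    (hw : ∀ i, SmoothAlong I' f (w i) p) (hli : LinearIndependent ℝ fun i => w i p) (i : Fin n) :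
    SmoothAlong I' f (fun q => InnerProductSpace.gramSchmidt ℝ (fun i => w i q) i) p := by
  induction i using WellFoundedLT.induction with
  | ind i ih =>
    have h (q : L) : InnerProductSpace.gramSchmidt ℝ (fun i => w i q) i = w i q
        - ∑ j ∈ Finset.Iio i,
          ((inner ℝ (InnerProductSpace.gramSchmidt ℝ (fun i => w i q) j) (w i q) : ℝ)
            / (inner ℝ (InnerProductSpace.gramSchmidt ℝ (fun i => w i q) j)
              (InnerProductSpace.gramSchmidt ℝ (fun i => w i q) j) : ℝ))
            • InnerProductSpace.gramSchmidt ℝ (fun i => w i q) j := by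
      have := InnerProductSpace.gramSchmidt_def'' ℝ (fun i => w i q) i
      simp only [real_inner_self_eq_norm_sq]
      exact eq_sub_of_add_eq this.symm
    simp only [h]
    refine (hw i).sub (smoothAlong_sum hf fun j hj => ?_)
    have hj := ih j (Finset.mem_Iio.1 hj)
    refine SmoothAlong.smul ((hj.inner (hw i)).div₀ (hj.inner hj) ?_) hj
    exact inner_self_ne_zero.2 (InnerProductSpace.gramSchmidt_ne_zero j hli)

theorem smoothAlong_gramSchmidtNormed {n : ℕ} {w : Fin n → Π q : L, TangentSpace I (f q)}
    (hf : ContMDiffAt I' I ∞ f p)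
    (hw : ∀ i, SmoothAlong I' f (w i) p) (hli : LinearIndependent ℝ fun i => w i p) (i : Fin n) :
    SmoothAlong I' f (fun q => InnerProductSpace.gramSchmidtNormed ℝ (fun i => w i q) i) p := by
  have h := smoothAlong_gramSchmidt hf hw hli i
  have h0 : (inner ℝ (InnerProductSpace.gramSchmidt ℝ (fun i => w i p) i)
      (InnerProductSpace.gramSchmidt ℝ (fun i => w i p) i) : ℝ) ≠ 0 :=
    inner_self_ne_zero.2 (InnerProductSpace.gramSchmidt_ne_zero i hli)
  simp only [InnerProductSpace.gramSchmidtNormed, norm_eq_sqrt_real_inner]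
  refine SmoothAlong.smul (ContMDiffAt.inv₀ ?_ ?_) h
  · exact ContMDiffAt.comp p (g := Real.sqrt) (Real.contDiffAt_sqrt h0).contMDiffAt (h.inner h)
  · exact Real.sqrt_ne_zero'.2 (lt_of_le_of_ne real_inner_self_nonneg h0.symm)

variable [FiniteDimensional ℝ E'] [IsManifold I' ∞ L]
  {J : Π x : M, TangentSpace I x →L[ℝ] TangentSpace I x}

theorem IsLagrangianImmersion.inner_apply_eq_zero (hf : IsLagrangianImmersion I I' J f) {q : L}
    {v w : TangentSpace I (f q)} (hv : v ∈ gaussMap I I' f q) (hw : w ∈ gaussMap I I' f q) :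
    (inner ℝ (J (f q) v) w : ℝ) = 0 := by
  obtain ⟨v, rfl⟩ := hv
  obtain ⟨w, rfl⟩ := hw
  exact hf.lagrangian q v w

theorem IsLagrangianImmersion.finrank_gaussMap (hf : IsLagrangianImmersion I I' J f) (q : L) :
    Module.finrank ℝ (gaussMap I I' f q) = Module.finrank ℝ E' :=
  LinearMap.finrank_range_of_inj (hf.immersion q)

/-- Near every point there is a smooth lift of the Gauss map to the unitary frame bundle: apply the
Gram-Schmidt process to the images under `df` of coordinate vector fields. -/
theorem IsLagrangianImmersion.exists_isGaussLift (hf : IsLagrangianImmersion I I' J f) {n : ℕ}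
    (hn : Module.finrank ℝ E' = n) (p : L) :
    ∃ (U : Set L) (s : Fin n → Π q : L, TangentSpace I (f q)), p ∈ U ∧
      IsGaussLift I' J f U s := by
  let b := Module.finBasisOfFinrankEq ℝ E' hn
  let t := trivializationAt E' (TangentSpace I') p
  let w (i : Fin n) (q : L) : TangentSpace I (f q) := mfderiv I' I f q (localField t (b i) q)
  have hli {q : L} (hq : q ∈ t.baseSet) : LinearIndependent ℝ fun i => w i q := by
    have h1 : Function.Injective ((mfderiv I' I f q).comp (t.symmL ℝ q)) :=
      (hf.immersion q).comp (Function.LeftInverse.injective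
        (g := fun v => (t ⟨q, v⟩).2) fun v => apply_symmL t hq v)
    exact b.linearIndependent.map' ((mfderiv I' I f q).comp (t.symmL ℝ q)).toLinearMap
      (LinearMap.ker_eq_bot.2 h1)
  have hspan {q : L} (hq : q ∈ t.baseSet) :
      Submodule.span ℝ (Set.range fun i => w i q) = gaussMap I I' f q := by
    refine Submodule.eq_of_le_of_finrank_eq ?_ ?_
    · rw [Submodule.span_le]
      rintro _ ⟨i, rfl⟩
      exact ⟨_, rfl⟩
    · rw [finrank_span_eq_card (hli hq), hf.finrank_gaussMap, hn, Fintype.card_fin]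
  have hspan' {q : L} (hq : q ∈ t.baseSet) : Submodule.span ℝ (Set.range fun i =>
      InnerProductSpace.gramSchmidtNormed ℝ (fun i => w i q) i) = gaussMap I I' f q := by
    rw [← hspan hq, InnerProductSpace.span_gramSchmidtNormed_range]
    exact InnerProductSpace.span_gramSchmidt _ _
  have hmem {q : L} (hq : q ∈ t.baseSet) (i : Fin n) :
      InnerProductSpace.gramSchmidtNormed ℝ (fun i => w i q) i ∈ gaussMap I I' f q := by
    rw [← hspan' hq]
    exact Submodule.subset_span ⟨i, rfl⟩
  refine ⟨t.baseSet, fun i q => InnerProductSpace.gramSchmidtNormed ℝ (fun i => w i q) i,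
    FiberBundle.mem_baseSet_trivializationAt' p, t.open_baseSet, ?_, ?_, fun q hq => hspan' hq⟩
  · intro i q hq
    exact ContMDiffAt.contMDiffWithinAt (smoothAlong_gramSchmidtNormed (hf.smooth q)
      (fun i => smoothAlong_mfderiv_localField hf.smooth hq (b i)) (hli hq) i)
  · intro q hq
    refine ⟨InnerProductSpace.gramSchmidtNormed_orthonormal (hli hq), fun i j => ?_⟩
    rw [real_inner_comm]
    exact hf.inner_apply_eq_zero (hmem hq j) (hmem hq i)

end Frames

/-! ### The Maslov form -/

section Maslov

variable {E : Type*} [NormedAddCommGroup E] [NormedSpace ℝ E] [FiniteDimensional ℝ E]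
  {H : Type*} [TopologicalSpace H] {I : ModelWithCorners ℝ E H}
  {M : Type*} [TopologicalSpace M] [ChartedSpace H M] [IsManifold I ∞ M]
  [RiemannianBundle (fun x : M => TangentSpace I x)]
  [IsContMDiffRiemannianBundle I ∞ E (fun x : M => TangentSpace I x)]
  {E' : Type*} [NormedAddCommGroup E'] [NormedSpace ℝ E'] [FiniteDimensional ℝ E']
  {H' : Type*} [TopologicalSpace H'] {I' : ModelWithCorners ℝ E' H'} [I'.Boundaryless]
  {L : Type*} [TopologicalSpace L] [ChartedSpace H' L] [IsManifold I' ∞ L]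
  {J : Π x : M, TangentSpace I x →L[ℝ] TangentSpace I x}
  {D D₁ : CovariantDerivative I E (fun x : M => TangentSpace I x)}
  {f : L → M} {p : L} {n : ℕ} {U : Set L} {e : Fin n → Π q : L, TangentSpace I (f q)}

variable (I') in
/-- The Hessian `(∇ df) (u, v)` of `f`, that is `D_v (df V)` where the vector field `V` extends `u`.
Its normal part is the second fundamental form. -/
noncomputable abbrev hessian (D : CovariantDerivative I E (fun x : M => TangentSpace I x))
    (f : L → M) (p : L) (u v : TangentSpace I' p) : TangentSpace I (f p) :=
  covAlong I' D f (fun q => mfderiv I' I f q (FiberBundle.extend E' u q)) p v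

theorem hessian_eq_add (u v : TangentSpace I' p) :
    hessian I' D₁ f p u v = hessian I' D f p u v
      + (D₁ (FiberBundle.extend E (mfderiv I' I f p u)) (f p) (mfderiv I' I f p v)
      - D (FiberBundle.extend E (mfderiv I' I f p u)) (f p) (mfderiv I' I f p v)) := by
  unfold hessian covAlong
  simp only [add_apply, ContinuousLinearMap.comp_apply, FiberBundle.extend_apply_self]
  abel

section Compare

variable (hJ : IsAlmostHermitian J) (hLC : IsLeviCivita D) (hNK : IsNearlyKahler J D)
  (hD₁ : IsCanonicalHermitian J D₁)
include hJ hLC hNK hD₁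

theorem hessian_self (u : TangentSpace I' p) : hessian I' D₁ f p u u = hessian I' D f p u u := by
  have h := hD₁.apply_self hJ hLC hNK (x := f p)
    (Y := FiberBundle.extend E (mfderiv I' I f p u)) (FiberBundle.mdifferentiableAt_extend ..)
  rw [FiberBundle.extend_apply_self] at h
  rw [hessian_eq_add (D := D), h, sub_self, add_zero]

theorem inner_hessian (u v : TangentSpace I' p) :
    (inner ℝ (J (f p) (mfderiv I' I f p u)) (hessian I' D₁ f p u v) : ℝ)
      = inner ℝ (J (f p) (mfderiv I' I f p u)) (hessian I' D f p u v) := by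
  have h := hD₁.inner_apply hJ hLC hNK (x := f p)
    (Y := FiberBundle.extend E (mfderiv I' I f p u)) (FiberBundle.mdifferentiableAt_extend ..)
    (mfderiv I' I f p v)
  rw [FiberBundle.extend_apply_self] at h
  rw [hessian_eq_add (D := D), inner_add_right, inner_sub_right, h, sub_self, add_zero]

theorem inner_hessian_left (u v : TangentSpace I' p) :
    (inner ℝ (J (f p) (mfderiv I' I f p u)) (hessian I' D₁ f p v u) : ℝ)
      = inner ℝ (J (f p) (mfderiv I' I f p u)) (hessian I' D f p v u) := by
  have h := hD₁.inner_apply_left hJ hLC hNK (x := f p)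
    (Y := FiberBundle.extend E (mfderiv I' I f p v)) (FiberBundle.mdifferentiableAt_extend ..)
    (mfderiv I' I f p u)
  rw [hessian_eq_add (D := D), inner_add_right, inner_sub_right, h, sub_self, add_zero]

end Compare

/-- Along a Lagrangian immersion, `⟨J df w, D_v s⟩` depends only on the value of the tangential
field `s` at the base point. -/
theorem IsLagrangianImmersion.inner_covAlong (hf : IsLagrangianImmersion I I' J f)
    (hJ : IsAlmostHermitian J) (hD₁ : IsCanonicalHermitian J D₁)
    {s : Π q : L, TangentSpace I (f q)} (hs : MDiffAlong I' f s p)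
    (hs' : ∀ᶠ q in nhds p, s q ∈ gaussMap I I' f q) (w v : TangentSpace I' p) :
    (inner ℝ (J (f p) (mfderiv I' I f p w)) (covAlong I' D₁ f s p v) : ℝ)
      = inner ℝ (hessian I' D₁ f p w v) (J (f p) (s p)) := by
  have hw := mdiffAlong_mfderiv_extend hf.smooth w
  have h := hD₁.metric.covAlong (hJ.mdiffAlong hw) hs v
  rw [mvfderiv_congr (g' := fun _ => (0 : ℝ)), mvfderiv_const,
    covAlong_apply_of_parallel hJ hD₁.parallel hw, hJ.inner_left,
    FiberBundle.extend_apply_self] at h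
  · have h' : (0 : ℝ) = _ := h
    linarith
  · -- The function `⟨J df W, s⟩` vanishes because `f` is Lagrangian.
    filter_upwards [hs'] with q hq
    exact hf.inner_apply_eq_zero ⟨_, rfl⟩ hq

section Lagrangian

variable (hf : IsLagrangianImmersion I I' J f)
  (hJ : IsAlmostHermitian J) (hLC : IsLeviCivita D) (hNK : IsNearlyKahler J D)
  (hD₁ : IsCanonicalHermitian J D₁)
include hf hJ hLC hNK hD₁

/-- `⟨B (u, u), J df v⟩ = ⟨J df u, D_u (df V)⟩`, where `B` is the second fundamental form for the
Levi-Civita connection, `D` is the canonical connection and `V` extends `v`. -/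
theorem IsLagrangianImmersion.inner_hessian_self (u v : TangentSpace I' p) :
    (inner ℝ (hessian I' D f p u u) (J (f p) (mfderiv I' I f p v)) : ℝ)
      = inner ℝ (J (f p) (mfderiv I' I f p u)) (hessian I' D₁ f p v u) := by
  rw [hf.inner_covAlong hJ hD₁ (mdiffAlong_mfderiv_extend hf.smooth v)
    (Filter.Eventually.of_forall fun q => ⟨_, rfl⟩), hessian_self hJ hLC hNK hD₁,
    FiberBundle.extend_apply_self]

/-- For a tangential field `s` with value `df u`, the form `⟨J s, D_v s⟩` of the canonical
connection is `⟨J df u, D_u (df V)⟩`, where `V` extends `v`. The symmetry of the Hessian needed for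
this holds for the Levi-Civita connection only; passing from one connection to the other does not
change the inner products with `J df u` of `(∇ df) (u, v)` and `(∇ df) (v, u)`. -/
theorem IsLagrangianImmersion.inner_covAlong_self {s : Π q : L, TangentSpace I (f q)}
    (hs : MDiffAlong I' f s p) (hs' : ∀ᶠ q in nhds p, s q ∈ gaussMap I I' f q)
    {u : TangentSpace I' p} (hu : mfderiv I' I f p u = s p) (v : TangentSpace I' p) :
    (inner ℝ (J (f p) (s p)) (covAlong I' D₁ f s p v) : ℝ)
      = inner ℝ (J (f p) (s p)) (hessian I' D₁ f p v u) := by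
  have hext : MDiffAlong I' f (fun q => mfderiv I' I f q (FiberBundle.extend E' u q)) p :=
    mdiffAlong_mfderiv_extend hf.smooth u
  have h1 := hf.inner_covAlong hJ hD₁ hs hs' u v
  have h2 := hf.inner_covAlong hJ hD₁ hext (Filter.Eventually.of_forall fun q => ⟨_, rfl⟩) u v
  rw [FiberBundle.extend_apply_self] at h2
  rw [← hu] at h1 ⊢
  rw [h1, ← h2, inner_hessian hJ hLC hNK hD₁, inner_hessian_left hJ hLC hNK hD₁]
  unfold hessian
  rw [covAlong_mfderiv_symm hLC.torsion_eq_zero hf.smooth u v]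

/-- The sum `∑ ⟨J e_i, D_{u_i} (df V)⟩` over an orthonormal basis `e_i = df u_i` of the tangent
space of `L`, where `V` extends `v`, is a trace, so that it does not depend on the basis. -/
theorem IsLagrangianImmersion.exists_trace (v : TangentSpace I' p) :
    ∃ c : ℝ, ∀ {ι : Type} [Fintype ι] (b : OrthonormalBasis ι ℝ (gaussMap I I' f p))
      (u : ι → TangentSpace I' p), (∀ i, mfderiv I' I f p (u i) = b i) →
      ∑ i, (inner ℝ (J (f p) (b i : TangentSpace I (f p))) (hessian I' D₁ f p v (u i)) : ℝ)
        = c := by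
  let A : TangentSpace I' p →ₗ[ℝ] TangentSpace I (f p) :=
    (covAlong I' D₁ f (fun q => mfderiv I' I f q (FiberBundle.extend E' v q)) p).toLinearMap
  let φ : TangentSpace I' p ≃ₗ[ℝ] gaussMap I I' f p :=
    LinearEquiv.ofInjective (mfderiv I' I f p).toLinearMap (hf.immersion p)
  let T : gaussMap I I' f p →ₗ[ℝ] gaussMap I I' f p :=
    (gaussMap I I' f p).orthogonalProjectionOnto.toLinearMap ∘ₗ (J (f p)).toLinearMap ∘ₗ A ∘ₗ
      φ.symm.toLinearMap
  refine ⟨-T.trace ℝ _, fun b u hu => ?_⟩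
  rw [LinearMap.trace_eq_sum_inner T b, ← Finset.sum_neg_distrib]
  refine Finset.sum_congr rfl fun i _ => ?_
  have h1 : φ.symm (b i) = u i := by
    rw [LinearEquiv.symm_apply_eq]
    exact Subtype.ext (hu i).symm
  have h2 : T (b i) = (gaussMap I I' f p).orthogonalProjectionOnto
      (J (f p) (hessian I' D₁ f p v (u i))) := by
    simp only [T, LinearMap.comp_apply, LinearEquiv.coe_coe, h1]
    rfl
  rw [h2, Submodule.inner_orthogonalProjectionOnto_eq_of_mem_left, hJ.inner_left]

/-- The 1-form `v ↦ ⟨H, J df v⟩` computed with the canonical connection, in an arbitrary orthonormal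
basis of the tangent space of `L`. -/
theorem IsLagrangianImmersion.sum_inner_hessian (v : TangentSpace I' p) {ι : Type}
    [Fintype ι] (b : OrthonormalBasis ι ℝ (gaussMap I I' f p)) (u : ι → TangentSpace I' p)
    (hu : ∀ i, mfderiv I' I f p (u i) = b i) :
    ∑ i, (inner ℝ (J (f p) (b i : TangentSpace I (f p))) (hessian I' D₁ f p v (u i)) : ℝ)
      = inner ℝ (meanCurvature I' D f p) (J (f p) (mfderiv I' I f p v)) := by
  obtain ⟨c, hc⟩ := hf.exists_trace hJ hLC hNK hD₁ v
  have key : (inner ℝ (meanCurvature I' D f p) (J (f p) (mfderiv I' I f p v)) : ℝ) = c := by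
    let b := stdOrthonormalBasis ℝ (gaussMap I I' f p)
    let u (i) : TangentSpace I' p := (LinearMap.mem_range.1 (b i).2).choose
    have hu (i) : mfderiv I' I f p (u i) = b i := (LinearMap.mem_range.1 (b i).2).choose_spec
    rw [← hc b u hu]
    have hH : meanCurvature I' D f p = ∑ i, secondFundamentalForm D f p (u i) (u i) := rfl
    rw [hH, sum_inner]
    refine Finset.sum_congr rfl fun i _ => ?_
    have hB : secondFundamentalForm D f p (u i) (u i) = hessian I' D f p (u i) (u i)
      - (gaussMap I I' f p).starProjection (hessian I' D f p (u i) (u i)) := rfl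
    have h0 : (inner ℝ ((gaussMap I I' f p).starProjection (hessian I' D f p (u i) (u i)))
        (J (f p) (mfderiv I' I f p v)) : ℝ) = 0 := by
      rw [real_inner_comm]
      exact hf.inner_apply_eq_zero ⟨v, rfl⟩ (Submodule.starProjection_apply_mem _ _)
    rw [hB, inner_sub_left, h0, sub_zero, hf.inner_hessian_self hJ hLC hNK hD₁, hu]
  rw [key, hc b u hu]

end Lagrangian

theorem IsGaussLift.smoothAlong (he : IsGaussLift I' J f U e) (hp : p ∈ U) (i : Fin n) :
    SmoothAlong I' f (e i) p :=
  (he.smooth i).contMDiffAt (he.isOpen.mem_nhds hp)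

theorem IsGaussLift.mem_gaussMap (he : IsGaussLift I' J f U e) (hp : p ∈ U) (i : Fin n) :
    e i p ∈ gaussMap I I' f p := by
  rw [← he.lifts p hp]
  exact Submodule.subset_span ⟨i, rfl⟩

theorem IsGaussLift.inner_eq (he : IsGaussLift I' J f U e) (hp : p ∈ U) (i j : Fin n) :
    (inner ℝ (e i p) (e j p) : ℝ) = if i = j then 1 else 0 :=
  orthonormal_iff_ite.1 (he.unitary p hp).1 i j

/-- For an adapted frame and the canonical connection, `∑ ⟨J e_i, D_v e_i⟩ = ⟨H, J df v⟩`. -/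
theorem IsGaussLift.sum_inner_covAlong (he : IsGaussLift I' J f U e) (hp : p ∈ U)
    (hf : IsLagrangianImmersion I I' J f)
    (hJ : IsAlmostHermitian J) (hLC : IsLeviCivita D) (hNK : IsNearlyKahler J D)
    (hD₁ : IsCanonicalHermitian J D₁) (v : TangentSpace I' p) :
    ∑ i, (inner ℝ (J (f p) (e i p)) (covAlong I' D₁ f (e i) p v) : ℝ)
      = inner ℝ (meanCurvature I' D f p) (J (f p) (mfderiv I' I f p v)) := by
  have hb : ∃ b : OrthonormalBasis (Fin n) ℝ (gaussMap I I' f p),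
      ∀ i, (b i : TangentSpace I (f p)) = e i p := by
    let w (i : Fin n) : gaussMap I I' f p := ⟨e i p, he.mem_gaussMap hp i⟩
    have hw : Orthonormal ℝ w := by
      rw [orthonormal_iff_ite]
      exact he.inner_eq hp
    have hspan : ⊤ ≤ Submodule.span ℝ (Set.range w) := by
      intro x _
      have hx : (x : TangentSpace I (f p)) ∈ Submodule.span ℝ (Set.range fun i => e i p) := by
        rw [he.lifts p hp]; exact x.2
      have h1 : Submodule.map (gaussMap I I' f p).subtype (Submodule.span ℝ (Set.range w))
          = Submodule.span ℝ (Set.range fun i => e i p) := by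
        rw [Submodule.map_span, ← Set.range_comp]
        rfl
      rw [← h1] at hx
      obtain ⟨y, hy, hyx⟩ := hx
      rwa [← Subtype.ext hyx]
    exact ⟨OrthonormalBasis.mk hw hspan, fun i => by simp [w]⟩
  obtain ⟨b, hb⟩ := hb
  choose u hu using fun i => LinearMap.mem_range.1 (he.mem_gaussMap hp i)
  rw [← hf.sum_inner_hessian hJ hLC hNK hD₁ v b u fun i => (hu i).trans (hb i).symm]
  refine Finset.sum_congr rfl fun i _ => ?_
  rw [hb, hf.inner_covAlong_self hJ hLC hNK hD₁ (he.smoothAlong hp i).mdiffAlong _ (hu i)]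
  filter_upwards [he.isOpen.mem_nhds hp] with q hq
  exact he.mem_gaussMap hq i

theorem IsGaussLift.inner_covAlong_add (he : IsGaussLift I' J f U e) (hp : p ∈ U)
    (hD₁ : IsMetric D₁) (v : TangentSpace I' p) (i j : Fin n) :
    (inner ℝ (covAlong I' D₁ f (e i) p v) (e j p) : ℝ)
      + inner ℝ (e i p) (covAlong I' D₁ f (e j) p v) = 0 := by
  rw [← hD₁.covAlong (he.smoothAlong hp i).mdiffAlong (he.smoothAlong hp j).mdiffAlong v,
    mvfderiv_congr (g' := fun _ => (if i = j then 1 else 0 : ℝ)), mvfderiv_const]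
  · rfl
  · filter_upwards [he.isOpen.mem_nhds hp] with q hq
    exact he.inner_eq hq i j

theorem IsGaussLift.inner_covAlong_self (he : IsGaussLift I' J f U e) (hp : p ∈ U)
    (hD₁ : IsMetric D₁) (v : TangentSpace I' p) (i : Fin n) :
    (inner ℝ (e i p) (covAlong I' D₁ f (e i) p v) : ℝ) = 0 := by
  have h := he.inner_covAlong_add hp hD₁ v i i
  rw [real_inner_comm] at h
  linarith

theorem IsGaussLift.gammaForm_eq (he : IsGaussLift I' J f U e) (hp : p ∈ U)
    (hf : IsLagrangianImmersion I I' J f)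
    (hJ : IsAlmostHermitian J) (hLC : IsLeviCivita D) (hNK : IsNearlyKahler J D)
    (hD₁ : IsCanonicalHermitian J D₁) (v : TangentSpace I' p) :
    gammaForm I' J D₁ f e p v
      = ((inner ℝ (meanCurvature I' D f p) (J (f p) (mfderiv I' I f p v)) : ℝ) : ℂ) := by
  rw [← he.sum_inner_covAlong hp hf hJ hLC hNK hD₁ v]
  unfold gammaForm connectionForm
  simp only [he.inner_covAlong_self hp hD₁.metric, Complex.ofReal_zero, zero_add]
  rw [← Finset.mul_sum, ← mul_assoc, neg_mul, Complex.I_mul_I, neg_neg, one_mul,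
    Complex.ofReal_sum]

/-- The 1-form `-2 L_ω (H)` is a Maslov form. -/
theorem IsLagrangianImmersion.isMaslovForm (hf : IsLagrangianImmersion I I' J f)
    (hJ : IsAlmostHermitian J) (hLC : IsLeviCivita D) (hNK : IsNearlyKahler J D)
    (hD₁ : IsCanonicalHermitian J D₁) (n : ℕ) :
    IsMaslovForm I' J D₁ n f fun p => (-2 : ℝ) •
      (lOmega J (f p) (meanCurvature I' D f p)).comp (mfderiv I' I f p) := by
  intro U e he p hp v
  rw [he.gammaForm_eq hp hf hJ hLC hNK hD₁]
  have h : (lOmega J (f p) (meanCurvature I' D f p)) (mfderiv I' I f p v)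
    = inner ℝ (J (f p) (meanCurvature I' D f p)) (mfderiv I' I f p v) := rfl
  rw [smul_apply, ContinuousLinearMap.comp_apply, h, hJ.inner_left]
  simp

/-- The Maslov form is unique, because the Gauss map has local lifts near every point. -/
theorem IsLagrangianImmersion.eq_of_isMaslovForm (hf : IsLagrangianImmersion I I' J f)
    (hn : Module.finrank ℝ E' = n) {μ μ' : Π p : L, TangentSpace I' p →L[ℝ] ℝ}
    (hμ : IsMaslovForm I' J D₁ n f μ) (hμ' : IsMaslovForm I' J D₁ n f μ') : μ = μ' := by
  funext p
  ext v
  obtain ⟨U, e, hp, he⟩ := hf.exists_isGaussLift hn p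
  exact Complex.ofReal_injective ((hμ U e he p hp v).trans (hμ' U e he p hp v).symm)

end Maslov

/-! ### The first Chern form of a minimal Lagrangian submanifold -/

section Chern

variable {E : Type*} [NormedAddCommGroup E] [NormedSpace ℝ E] [FiniteDimensional ℝ E]
  {H : Type*} [TopologicalSpace H] {I : ModelWithCorners ℝ E H} [I.Boundaryless]
  {M : Type*} [TopologicalSpace M] [T2Space M] [ChartedSpace H M] [IsManifold I ∞ M]
  [RiemannianBundle (fun x : M => TangentSpace I x)]
  [IsContMDiffRiemannianBundle I ∞ E (fun x : M => TangentSpace I x)]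
  {E' : Type*} [NormedAddCommGroup E'] [NormedSpace ℝ E'] [FiniteDimensional ℝ E']
  {H' : Type*} [TopologicalSpace H'] {I' : ModelWithCorners ℝ E' H'} [I'.Boundaryless]
  {L : Type*} [TopologicalSpace L] [ChartedSpace H' L] [IsManifold I' ∞ L]
  {J : Π x : M, TangentSpace I x →L[ℝ] TangentSpace I x}
  {D D₁ : CovariantDerivative I E (fun x : M => TangentSpace I x)}
  {f : L → M} {p : L} {n : ℕ} {U : Set L} {e : Fin n → Π q : L, TangentSpace I (f q)}

theorem mdiffAt_and_mvfderiv_fun_sum {F : Type*} [NormedAddCommGroup F] [NormedSpace ℝ F]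
    {ι : Type*} {S : Finset ι} {g : ι → L → F} (hg : ∀ i ∈ S, MDiffAt (g i) p) :
    MDiffAt (fun q => ∑ i ∈ S, g i q) p ∧
      mvfderiv I' (fun q => ∑ i ∈ S, g i q) p = ∑ i ∈ S, mvfderiv I' (g i) p := by
  classical
  induction S using Finset.induction_on with
  | empty =>
    simp only [Finset.sum_empty]
    exact ⟨mdifferentiableAt_const, mvfderiv_const 0⟩
  | insert i S hi ih =>
    obtain ⟨h1, h2⟩ := ih fun j hj => hg j (Finset.mem_insert_of_mem hj)
    have h3 := hg i (Finset.mem_insert_self i S)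
    simp only [Finset.sum_insert hi]
    exact ⟨h3.add h1, by rw [mvfderiv_fun_add h3 h1, h2]⟩

/-- Linearity of `curvature D x u v w` in `w` is read off from the formula in a chart. -/
theorem exists_linearMap_curvature (hD : D.ContMDiffCovariantDerivative ∞) (x : M)
    (u v : TangentSpace I x) :
    ∃ R : TangentSpace I x →ₗ[ℝ] TangentSpace I x, ∀ w, R w = curvature D x u v w := by
  have hx := FiberBundle.mem_baseSet_trivializationAt' (F := E)
    (E := fun x : M => TangentSpace I x) x
  let t := trivializationAt E (TangentSpace I) x
  have h (w : TangentSpace I x) := congrArg (t.symmL ℝ x) (apply_curvature hD x u v w)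
  have h' (w : TangentSpace I x) : t.symmL ℝ x (t ⟨x, curvature D x u v w⟩).2
      = curvature D x u v w := symmL_apply_apply t hx _
  refine ⟨⟨⟨fun w => curvature D x u v w, fun w w' => ?_⟩, fun c w => ?_⟩, fun w => rfl⟩
  · rw [← h' (w + w'), ← h' w, ← h' w', h, h, h]
    simp only [(trivialization_linear t hx).map_add, map_add, map_sub, t]
    abel
  · simp only [RingHom.id_apply]
    rw [← h' (c • w), ← h' w, h, h]
    simp only [(trivialization_linear t hx).map_smul, map_smul, map_add, map_sub, t, smul_add,
      smul_sub]

/-- A unitary frame, completed to an orthonormal basis of the tangent space. -/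
theorem IsUnitaryFrame.exists_orthonormalBasis (hJ : IsAlmostHermitian J) {x : M}
    {e : Fin n → TangentSpace I x} (he : IsUnitaryFrame J x e)
    (hn : Module.finrank ℝ E = 2 * n) :
    ∃ b : OrthonormalBasis (Fin n ⊕ Fin n) ℝ (TangentSpace I x),
      (∀ i, b (Sum.inl i) = e i) ∧ ∀ i, b (Sum.inr i) = J x (e i) := by
  let w : Fin n ⊕ Fin n → TangentSpace I x := Sum.elim e fun i => J x (e i)
  have hw : Orthonormal ℝ w := by
    rw [orthonormal_iff_ite]
    have h1 := orthonormal_iff_ite.1 he.1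
    rintro (i | i) (j | j)
    · simpa [w] using h1 i j
    · simpa [w] using he.2 i j
    · simpa [w, real_inner_comm] using he.2 j i
    · simpa [w, hJ.orthogonal] using h1 i j
  have hcard : Fintype.card (Fin n ⊕ Fin n) = Module.finrank ℝ (TangentSpace I x) := by
    rw [Fintype.card_sum, Fintype.card_fin, ← two_mul]
    exact hn.symm
  have hspan : ⊤ ≤ Submodule.span ℝ (Set.range w) :=
    (hw.linearIndependent.span_eq_top_of_card_eq_finrank' hcard).ge
  exact ⟨OrthonormalBasis.mk hw hspan, fun i => by simp [w], fun i => by simp [w]⟩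

/-- A complex linear endomorphism has vanishing complex trace as soon as the trace vanishes in a
unitary frame. -/
theorem complexTrace_eq_zero (hJ : IsAlmostHermitian J) {x : M}
    {e : Fin n → TangentSpace I x} (he : IsUnitaryFrame J x e)
    (hn : Module.finrank ℝ E = 2 * n) (R : TangentSpace I x →ₗ[ℝ] TangentSpace I x)
    (hRJ : ∀ i, R (J x (e i)) = J x (R (e i)))
    (h1 : ∑ i, (inner ℝ (e i) (R (e i)) : ℝ) = 0)
    (h2 : ∑ i, (inner ℝ (J x (e i)) (R (e i)) : ℝ) = 0) : complexTrace J x R = 0 := by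
  obtain ⟨b, hb, hb'⟩ := he.exists_orthonormalBasis hJ hn
  have k1 : ∑ k, (inner ℝ (stdOrthonormalBasis ℝ (TangentSpace I x) k)
      (R (stdOrthonormalBasis ℝ (TangentSpace I x) k)) : ℝ) = 0 := by
    rw [← LinearMap.trace_eq_sum_inner R, LinearMap.trace_eq_sum_inner R b]
    simp only [Fintype.sum_sum_type, hb, hb', hRJ, hJ.orthogonal, h1, add_zero]
  have k2 : ∑ k, (inner ℝ (stdOrthonormalBasis ℝ (TangentSpace I x) k)
      (J x (R (stdOrthonormalBasis ℝ (TangentSpace I x) k))) : ℝ) = 0 := by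
    have h (w : TangentSpace I x) : J x (R w) = ((J x).toLinearMap ∘ₗ R) w := rfl
    simp only [h]
    rw [← LinearMap.trace_eq_sum_inner, LinearMap.trace_eq_sum_inner _ b]
    simp only [Fintype.sum_sum_type, hb, hb', LinearMap.comp_apply, hRJ,
      ContinuousLinearMap.coe_coe, hJ.sq, inner_neg_right]
    have h3 (i : Fin n) : (inner ℝ (e i) (J x (R (e i))) : ℝ) = -inner ℝ (J x (e i)) (R (e i)) := by
      rw [hJ.inner_left, neg_neg]
    simp only [h3, Finset.sum_neg_distrib, h2, neg_zero, add_zero]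
  unfold complexTrace
  simp only [Finset.sum_sub_distrib, ← Finset.mul_sum, ← Complex.ofReal_sum]
  rw [k1, k2]
  simp

/-- Covariant derivatives `X_i = D_a e_i`, `Y_i = D_b e_i` of an adapted frame satisfy
`∑ ⟨J X_i, Y_i⟩ = 0`: with respect to `(e_k, J e_k)` their matrices have a skew real part and a
symmetric imaginary part. -/
theorem IsUnitaryFrame.sum_inner_eq_zero (hJ : IsAlmostHermitian J) {x : M}
    {e : Fin n → TangentSpace I x} (he : IsUnitaryFrame J x e)
    (hn : Module.finrank ℝ E = 2 * n) {X Y : Fin n → TangentSpace I x}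
    (hX : ∀ i j, (inner ℝ (e i) (X j) : ℝ) = -inner ℝ (e j) (X i))
    (hX' : ∀ i j, (inner ℝ (J x (e i)) (X j) : ℝ) = inner ℝ (J x (e j)) (X i))
    (hY : ∀ i j, (inner ℝ (e i) (Y j) : ℝ) = -inner ℝ (e j) (Y i))
    (hY' : ∀ i j, (inner ℝ (J x (e i)) (Y j) : ℝ) = inner ℝ (J x (e j)) (Y i)) :
    ∑ i, (inner ℝ (J x (X i)) (Y i) : ℝ) = 0 := by
  obtain ⟨b, hb, hb'⟩ := he.exists_orthonormalBasis hJ hn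
  -- Expansion in the orthonormal basis `(e_k, J e_k)`.
  have h (i : Fin n) : (inner ℝ (J x (X i)) (Y i) : ℝ)
      = ∑ k, ((inner ℝ (e k) (X i) : ℝ) * inner ℝ (J x (e k)) (Y i)
        - inner ℝ (J x (e k)) (X i) * inner ℝ (e k) (Y i)) := by
    rw [← b.sum_inner_mul_inner, Fintype.sum_sum_type, ← Finset.sum_add_distrib]
    refine Finset.sum_congr rfl fun k _ => ?_
    rw [hb, hb', hJ.orthogonal, hJ.inner_left, real_inner_comm (X i), real_inner_comm (X i)]
    ring
  -- Exchanging the summation indices changes the sign of each of the two double sums.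
  have k1 : ∑ i, ∑ k, (inner ℝ (e k) (X i) : ℝ) * inner ℝ (J x (e k)) (Y i) = 0 := by
    have h1 : ∑ i, ∑ k, (inner ℝ (e k) (X i) : ℝ) * inner ℝ (J x (e k)) (Y i)
        = -∑ i, ∑ k, (inner ℝ (e k) (X i) : ℝ) * inner ℝ (J x (e k)) (Y i) := by
      conv_lhs => rw [Finset.sum_comm]
      simp only [← Finset.sum_neg_distrib]
      refine Finset.sum_congr rfl fun i _ => Finset.sum_congr rfl fun k _ => ?_
      rw [hX i k, hY' i k]
      ring
    linarith
  have k2 : ∑ i, ∑ k, (inner ℝ (J x (e k)) (X i) : ℝ) * inner ℝ (e k) (Y i) = 0 := by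
    have h1 : ∑ i, ∑ k, (inner ℝ (J x (e k)) (X i) : ℝ) * inner ℝ (e k) (Y i)
        = -∑ i, ∑ k, (inner ℝ (J x (e k)) (X i) : ℝ) * inner ℝ (e k) (Y i) := by
      conv_lhs => rw [Finset.sum_comm]
      simp only [← Finset.sum_neg_distrib]
      refine Finset.sum_congr rfl fun i _ => Finset.sum_congr rfl fun k _ => ?_
      rw [hX' i k, hY i k]
      ring
    linarith
  simp only [h, Finset.sum_sub_distrib, k1, k2, sub_zero]

theorem IsAlmostHermitian.smoothAlong (hJ : IsAlmostHermitian J)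
    {s : Π q : L, TangentSpace I (f q)} (hs : SmoothAlong I' f s p) :
    SmoothAlong I' f (fun q => J (f q) (s q)) p :=
  ContMDiffAt.clm_bundle_apply (b := f) (F₁ := E) (F₂ := E)
    (E₁ := fun x : M => TangentSpace I x) (E₂ := fun x : M => TangentSpace I x) (IB := I)
    (ϕ := fun q => J (f q)) (ContMDiffAt.comp (I' := I) p
      (g := fun x => TotalSpace.mk' (E →L[ℝ] E)
        (E := fun x : M => TangentSpace I x →L[ℝ] TangentSpace I x) x (J x))
      (hJ.smooth (f p)) hs.base) hs

/-- Symmetry of `⟨J e_i, D_v e_j⟩`: differentiate `⟨J e_i, e_j⟩ = 0`. -/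
theorem IsGaussLift.inner_apply_covAlong (he : IsGaussLift I' J f U e) (hp : p ∈ U)
    (hJ : IsAlmostHermitian J) (hD₁ : IsCanonicalHermitian J D₁) (v : TangentSpace I' p)
    (i j : Fin n) :
    (inner ℝ (J (f p) (e i p)) (covAlong I' D₁ f (e j) p v) : ℝ)
      = inner ℝ (J (f p) (e j p)) (covAlong I' D₁ f (e i) p v) := by
  have hi := (he.smoothAlong hp i).mdiffAlong
  have h := hD₁.metric.covAlong (hJ.mdiffAlong hi) (he.smoothAlong hp j).mdiffAlong v
  rw [mvfderiv_congr (g' := fun _ => (0 : ℝ)), mvfderiv_const,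
    covAlong_apply_of_parallel hJ hD₁.parallel hi, hJ.inner_left, real_inner_comm] at h
  · have h' : (0 : ℝ) = _ := h
    linarith
  · filter_upwards [he.isOpen.mem_nhds hp] with q hq
    rw [real_inner_comm]
    exact (he.unitary q hq).2 j i

section Curvature

variable (he : IsGaussLift I' J f U e) (hp : p ∈ U) (hfs : ContMDiff I' I ∞ f)
  (hJ : IsAlmostHermitian J) (hD₁ : IsCanonicalHermitian J D₁) (a b : E')
include he hp hfs hJ hD₁

theorem IsGaussLift.partialAlong_apply (i : Fin n) :
    partialAlong I' D₁ f (partialAlong I' D₁ f (fun q => J (f q) (e i q)) p b) p a p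
      = J (f p) (partialAlong I' D₁ f (partialAlong I' D₁ f (e i) p b) p a p) := by
  have h : ∀ᶠ q in nhds p, partialAlong I' D₁ f (fun q => J (f q) (e i q)) p b q
      = J (f q) (partialAlong I' D₁ f (e i) p b q) := by
    filter_upwards [(he.smoothAlong hp i).eventually_mdiffAlong] with q hq
    exact covAlong_apply_of_parallel hJ hD₁.parallel hq _
  unfold partialAlong at h ⊢
  rw [covAlong_congr h]
  exact covAlong_apply_of_parallel hJ hD₁.parallel
    (mdiffAlong_partialAlong hD₁.smooth hfs (he.smoothAlong hp i) b) _

/-- `R (J e_i) = J (R e_i)`, because the covariant derivative along `f` commutes with `J`. -/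
theorem IsGaussLift.curvature_apply (i : Fin n) :
    curvature D₁ (f p)
      (mfderiv I' I f p (localField (trivializationAt E' (TangentSpace I') p) a p))
      (mfderiv I' I f p (localField (trivializationAt E' (TangentSpace I') p) b p))
      (J (f p) (e i p))
    = J (f p) (curvature D₁ (f p)
      (mfderiv I' I f p (localField (trivializationAt E' (TangentSpace I') p) a p))
      (mfderiv I' I f p (localField (trivializationAt E' (TangentSpace I') p) b p)) (e i p)) := by
  rw [curvature_eq_partialAlong hD₁.smooth hfs (he.smoothAlong hp i),
    curvature_eq_partialAlong hD₁.smooth hfs (hJ.smoothAlong (he.smoothAlong hp i)),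
    he.partialAlong_apply hp hfs hJ hD₁, he.partialAlong_apply hp hfs hJ hD₁, map_sub]

/-- `⟨e_i, R e_i⟩ = 0`: differentiate `⟨e_i, D e_i⟩ = 0` and antisymmetrize. -/
theorem IsGaussLift.inner_curvature_self (i : Fin n) :
    (inner ℝ (e i p) (curvature D₁ (f p)
      (mfderiv I' I f p (localField (trivializationAt E' (TangentSpace I') p) a p))
      (mfderiv I' I f p (localField (trivializationAt E' (TangentSpace I') p) b p)) (e i p)) : ℝ)
      = 0 := by
  have h (a b : E') : (inner ℝ (partialAlong I' D₁ f (e i) p a p)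
        (partialAlong I' D₁ f (e i) p b p) : ℝ)
      + inner ℝ (e i p) (partialAlong I' D₁ f (partialAlong I' D₁ f (e i) p b) p a p) = 0 := by
    have h1 := hD₁.metric.covAlong (he.smoothAlong hp i).mdiffAlong
      (mdiffAlong_partialAlong hD₁.smooth hfs (he.smoothAlong hp i) b)
      (localField (trivializationAt E' (TangentSpace I') p) a p)
    rw [mvfderiv_congr (g' := fun _ => (0 : ℝ)), mvfderiv_const] at h1
    · exact h1.symm
    · filter_upwards [he.isOpen.mem_nhds hp] with q hq
      exact he.inner_covAlong_self hq hD₁.metric _ i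
  have h1 := h a b
  have h2 := h b a
  rw [curvature_eq_partialAlong hD₁.smooth hfs (he.smoothAlong hp i), inner_sub_right]
  rw [real_inner_comm] at h2
  linarith

/-- If `∑ ⟨J e_i, D e_i⟩`, the pull-back of `γ`, vanishes on `U`, then so does its exterior
derivative `∑ ⟨J e_i, R e_i⟩`; the quadratic terms cancel by `IsUnitaryFrame.sum_inner_eq_zero`. -/
theorem IsGaussLift.sum_inner_curvature (hn : Module.finrank ℝ E = 2 * n)
    (hγ : ∀ q ∈ U, ∀ v : TangentSpace I' q,
      ∑ i, (inner ℝ (J (f q) (e i q)) (covAlong I' D₁ f (e i) q v) : ℝ) = 0) :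
    ∑ i, (inner ℝ (J (f p) (e i p)) (curvature D₁ (f p)
      (mfderiv I' I f p (localField (trivializationAt E' (TangentSpace I') p) a p))
      (mfderiv I' I f p (localField (trivializationAt E' (TangentSpace I') p) b p)) (e i p)) : ℝ)
      = 0 := by
  have h (a b : E') : ∑ i, ((inner ℝ (J (f p) (partialAlong I' D₁ f (e i) p a p))
        (partialAlong I' D₁ f (e i) p b p) : ℝ)
      + inner ℝ (J (f p) (e i p))
        (partialAlong I' D₁ f (partialAlong I' D₁ f (e i) p b) p a p)) = 0 := by
    have hi (i : Fin n) := hJ.mdiffAlong (he.smoothAlong hp i).mdiffAlong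
    have hi' (i : Fin n) := mdiffAlong_partialAlong hD₁.smooth hfs (he.smoothAlong hp i) b
    have h1 (i : Fin n) := hD₁.metric.covAlong (hi i) (hi' i)
      (localField (trivializationAt E' (TangentSpace I') p) a p)
    simp only [covAlong_apply_of_parallel hJ hD₁.parallel (he.smoothAlong hp _).mdiffAlong] at h1
    refine (Finset.sum_congr rfl fun i _ => (h1 i).symm).trans ?_
    rw [← sum_apply, ← (mdiffAt_and_mvfderiv_fun_sum fun i _ => (hi i).inner (hi' i)).2,
      mvfderiv_congr (g' := fun _ => (0 : ℝ)), mvfderiv_const]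
    · rfl
    · filter_upwards [he.isOpen.mem_nhds hp] with q hq
      exact hγ q hq _
  have hskew (a : E') (i j : Fin n) : (inner ℝ (e i p) (partialAlong I' D₁ f (e j) p a p) : ℝ)
      = -inner ℝ (e j p) (partialAlong I' D₁ f (e i) p a p) := by
    have := he.inner_covAlong_add hp hD₁.metric
      (localField (trivializationAt E' (TangentSpace I') p) a p) i j
    rw [real_inner_comm] at this
    exact eq_neg_of_add_eq_zero_right this
  have hsymm (a : E') (i j : Fin n) :
      (inner ℝ (J (f p) (e i p)) (partialAlong I' D₁ f (e j) p a p) : ℝ)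
      = inner ℝ (J (f p) (e j p)) (partialAlong I' D₁ f (e i) p a p) :=
    he.inner_apply_covAlong hp hJ hD₁ _ i j
  have k (a b : E') := (he.unitary p hp).sum_inner_eq_zero hJ hn (hskew a) (hsymm a) (hskew b)
    (hsymm b)
  have h1 := h a b
  have h2 := h b a
  rw [Finset.sum_add_distrib, k, zero_add] at h1 h2
  simp only [curvature_eq_partialAlong hD₁.smooth hfs (he.smoothAlong hp _), inner_sub_right,
    Finset.sum_sub_distrib, h1, h2, sub_zero]

end Curvature

theorem IsLagrangianImmersion.firstChernForm_eq_zero (hf : IsLagrangianImmersion I I' J f)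
    (hJ : IsAlmostHermitian J) (hLC : IsLeviCivita D) (hNK : IsNearlyKahler J D)
    (hD₁ : IsCanonicalHermitian J D₁) (hn : Module.finrank ℝ E = 2 * n)
    (hn' : Module.finrank ℝ E' = n) (hH : ∀ p : L, meanCurvature I' D f p = 0) (p : L)
    (u v : TangentSpace I' p) :
    firstChernForm J D₁ (f p) (mfderiv I' I f p u) (mfderiv I' I f p v) = 0 := by
  obtain ⟨U, e, hp, he⟩ := hf.exists_isGaussLift hn' p
  obtain ⟨R, hR⟩ := exists_linearMap_curvature hD₁.smooth (f p) (mfderiv I' I f p u)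
    (mfderiv I' I f p v)
  have hp' : p ∈ (trivializationAt E' (TangentSpace I') p).baseSet :=
    FiberBundle.mem_baseSet_trivializationAt' p
  set a := (trivializationAt E' (TangentSpace I') p ⟨p, u⟩).2 with ha
  set b := (trivializationAt E' (TangentSpace I') p ⟨p, v⟩).2 with hb
  have h1 := he.curvature_apply hp hf.smooth hJ hD₁ a b
  have h2 := he.inner_curvature_self hp hf.smooth hJ hD₁ a b
  have h3 := he.sum_inner_curvature hp hf.smooth hJ hD₁ a b hn fun q hq v => by
    rw [he.sum_inner_covAlong hq hf hJ hLC hNK hD₁ v, hH, inner_zero_left]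
  rw [ha, hb, localField_eq_self hp', localField_eq_self hp'] at h3
  simp only [ha, hb, localField_eq_self hp', ← hR] at h1 h2 h3
  have h4 : (fun w => curvature D₁ (f p) (mfderiv I' I f p u) (mfderiv I' I f p v) w) = R := by
    funext w
    exact (hR w).symm
  unfold firstChernForm
  rw [h4, complexTrace_eq_zero hJ (he.unitary p hp) hn R h1 (Finset.sum_eq_zero fun i _ => h2 i) h3,
    mul_zero]

end Chern

end NearlyKahler

theorem mainTheorem5 (n : ℕ)
    {M : Type*} [TopologicalSpace M] [T2Space M]
    [ChartedSpace (EuclideanSpace ℝ (Fin (2 * n))) M] [IsManifold (𝓡 (2 * n)) ∞ M]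
    [RiemannianBundle (fun x : M => TangentSpace (𝓡 (2 * n)) x)]
    [IsContMDiffRiemannianBundle (𝓡 (2 * n)) ∞ (EuclideanSpace ℝ (Fin (2 * n)))
      (fun x : M => TangentSpace (𝓡 (2 * n)) x)]
    (J : Π x : M, TangentSpace (𝓡 (2 * n)) x →L[ℝ] TangentSpace (𝓡 (2 * n)) x)
    (hJ : NearlyKahler.IsAlmostHermitian J)
    (nablaLC : CovariantDerivative (𝓡 (2 * n)) (EuclideanSpace ℝ (Fin (2 * n)))
      (fun x : M => TangentSpace (𝓡 (2 * n)) x))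
    (hLC : NearlyKahler.IsLeviCivita nablaLC)
    (hNK : NearlyKahler.IsNearlyKahler J nablaLC)
    {L : Type*} [TopologicalSpace L] [T2Space L]
    [ChartedSpace (EuclideanSpace ℝ (Fin n)) L] [IsManifold (𝓡 n) ∞ L]
    (f : L → M) (hf : NearlyKahler.IsLagrangianImmersion (𝓡 (2 * n)) (𝓡 n) J f) :
    (∃ nablaCan : CovariantDerivative (𝓡 (2 * n)) (EuclideanSpace ℝ (Fin (2 * n)))
        (fun x : M => TangentSpace (𝓡 (2 * n)) x), NearlyKahler.IsCanonicalHermitian J nablaCan) ∧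
    ∀ nablaCan : CovariantDerivative (𝓡 (2 * n)) (EuclideanSpace ℝ (Fin (2 * n)))
        (fun x : M => TangentSpace (𝓡 (2 * n)) x), NearlyKahler.IsCanonicalHermitian J nablaCan →
      (∃! μ : Π p : L, TangentSpace (𝓡 n) p →L[ℝ] ℝ,
        NearlyKahler.IsMaslovForm (𝓡 n) J nablaCan n f μ) ∧
      (∀ μ : Π p : L, TangentSpace (𝓡 n) p →L[ℝ] ℝ,
        NearlyKahler.IsMaslovForm (𝓡 n) J nablaCan n f μ →
        ∀ p : L, (-2 : ℝ) • (NearlyKahler.lOmega J (f p)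
            (NearlyKahler.meanCurvature (𝓡 n) nablaLC f p)).comp
              (mfderiv (𝓡 n) (𝓡 (2 * n)) f p) = μ p) ∧
      ((∀ p : L, NearlyKahler.meanCurvature (𝓡 n) nablaLC f p = 0) →
        ∀ (p : L) (u v : TangentSpace (𝓡 n) p),
          NearlyKahler.firstChernForm J nablaCan (f p)
            (mfderiv (𝓡 n) (𝓡 (2 * n)) f p u) (mfderiv (𝓡 n) (𝓡 (2 * n)) f p v) = 0) := by
  refine ⟨⟨_, NearlyKahler.isCanonicalHermitian_canonicalConnection hJ hLC hNK⟩,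
    fun nablaCan hCan => ?_⟩
  have hμ := hf.isMaslovForm hJ hLC hNK hCan n
  -- By uniqueness, every Maslov form is the explicit one.
  have huniq {μ μ' : Π p : L, TangentSpace (𝓡 n) p →L[ℝ] ℝ}
      (h : NearlyKahler.IsMaslovForm (𝓡 n) J nablaCan n f μ)
      (h' : NearlyKahler.IsMaslovForm (𝓡 n) J nablaCan n f μ') : μ = μ' :=
    hf.eq_of_isMaslovForm finrank_euclideanSpace_fin h h'
  exact ⟨⟨_, hμ, fun μ h => huniq h hμ⟩, fun μ h p => congrFun (huniq hμ h) p,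
    fun hH p u v => hf.firstChernForm_eq_zero hJ hLC hNK hCan finrank_euclideanSpace_fin
      finrank_euclideanSpace_fin hH p u v⟩
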